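/- Let $X$ be a non-empty set. Let $\Delta_X$ be the set of probability measures $\mu$ defined on all subsets of $X$ such that, for every $n$, every subset of $X^n$ is measurable for the completed product measure $\mu^n$ (for example, every discrete probability measure on $X$). A predictor is a function $p:X\to[0,1]$; for $\mu\in\Delta_X$ let $\mu_p$ be the law of $(x,o)\in X\times\{0,1\}$ with $x\sim\mu$ and $o\sim\mathrm{Ber}(p(x))$. A (randomized) distinguisher $d$ accepts a pair $(x,o)$ with some probability $\Pr[d(x,o)=\mathrm{ACCEPT}]\in[0,1]$; put $f_d(x)=\Pr[d(x,1)=\mathrm{ACCEPT}]-\Pr[d(x,0)=\mathrm{ACCEPT}]\in[-1,1]$. For a non-empty class $\mathcal D$ of distinguishers and predictors $p,q$ let $$\mathrm{adv}_{\mu,\mathcal D}(p,q)=\sup_{d\in\mathcal D}\Big|\Pr_{(x,o)\sim\mu_p}[d(x,o)=\mathrm{ACCEPT}]-\Pr_{(x,o)\sim\mu_q}[d(x,o)=\mathrm{ACCEPT}]\Big|.$$ For $\gamma\ge 0$ let $\mathrm{fat}_{\mathcal D}(\gamma)\in\{0,1,2,\dots\}\cup\{\infty\}$ be the supremum of the $n$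 for which there are $x_1,\dots,x_n\in X$ and $r_1,\dots,r_n\in\mathbb R$ such that for every $b\in\{-1,1\}^n$ some $d\in\mathcal D$ satisfies $b_i(f_d(x_i)-r_i)\ge\gamma$ for all $i$. A learner with $n$ examples is a possibly randomized map from $(X\times\{0,1\})^n$ to predictors. For a class $\mathcal P\subseteq[0,1]^X$ let $\mathsf{SAMP\text{-}DF\text{-}R}(\mathcal P,\mathcal D,\varepsilon,\delta)\in\{0,1,2,\dots\}\cup\{\infty\}$ be the infimum of the $n\ge 0$ for which there is a learner such that, for every $\mu\in\Delta_X$ and every $p^*\in\mathcal P$, given $n$ i.i.d. examples from $\mu_{p^*}$ it outputs, with probability at least $1-\delta$, a predictor $p$ with $\mathrm{adv}_{\mu,\mathcal D}(p,p^*)\le\varepsilon$. Let $\mathsf{SAMP\text{-}DF\text{-}A}(\mathcal P,\mathcal D,\varepsilon,\delta)$ be defined in the same way, with $p^*$ ranging over all of $[0,1]^X$ and the requirement $\mathrm{adv}_{\mu,\mathcal D}(p,p^*)\le\inf_{p'\in\mathcal P}\mathrm{adv}_{\mu,\mathcal D}(p',p^*)+\varepsilon$. Theorem. There is an absolute constant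 $C>0$ such that for every non-empty set $X$, every non-empty class $\mathcal D$ of distinguishers on $X$, every $\varepsilon\in(0,1)$ and every $\delta\in(0,1)$, $$\frac{\mathrm{fat}_{\mathcal D}(12\varepsilon)}{8}+\log_2(1-\delta)\;\le\;\mathsf{SAMP\text{-}DF\text{-}R}([0,1]^X,\mathcal D,\varepsilon,\delta)\;=\;\mathsf{SAMP\text{-}DF\text{-}A}([0,1]^X,\mathcal D,\varepsilon,\delta)$$ $$\le\; C\,\varepsilon^{-4}\Big(\mathrm{fat}_{\mathcal D}(\varepsilon/25)\,(\log_2(2/\varepsilon))^2+\log_2(2/\delta)\Big),$$ where all three quantities may be infinite. -/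

import Mathlib

open MeasureTheory ProbabilityTheory

namespace OutcomeInd

universe u

/-- Predictors, i.e. elements of `[0,1]^X`. -/
abbrev Predictor (X : Type u) : Type u := X → Set.Icc (0 : ℝ) 1

/-- Randomized no-access distinguishers: `d x o` is the probability (over the internal randomness)
that the distinguisher accepts the individual-outcome pair `(x, o)`. The outcomes `0`, `1` are
`false`, `true`. -/
abbrev Distinguisher (X : Type u) : Type u := X → Bool → Set.Icc (0 : ℝ) 1

/-- The function `f_d : X → [-1,1]` of a distinguisher `d`. -/
def Distinguisher.toFun {X : Type u} (d : Distinguisher X) : X → ℝ :=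
  fun x => (d x true : ℝ) - (d x false : ℝ)

/-- The function class `{f_d : d ∈ D}` represented by a distinguisher class `D`. -/
def functionClass {X : Type u} (D : Set (Distinguisher X)) : Set (X → ℝ) :=
  Distinguisher.toFun '' D

/-- `x 1, …, x n` are `γ`-fat shattered by `F`. -/
def FatShattered {X : Type u} (F : Set (X → ℝ)) (γ : ℝ) {n : ℕ} (x : Fin n → X) : Prop :=
  ∃ r : Fin n → ℝ, ∀ b : Fin n → ℝ, (∀ i, b i = -1 ∨ b i = 1) →
    ∃ f ∈ F, ∀ i, γ ≤ b i * (f (x i) - r i)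

/-- The `γ`-fat-shattering dimension, possibly infinite. -/
noncomputable def fat {X : Type u} (F : Set (X → ℝ)) (γ : ℝ) : ℕ∞ :=
  ⨆ n ∈ {n : ℕ | ∃ x : Fin n → X, FatShattered F γ x}, (n : ℕ∞)

section Learning

variable {X : Type u} [MeasurableSpace X] [DiscreteMeasurableSpace X]

/-- The distributions over `X`: probability measures for which every subset of `X`, and every set
of finite sequences of individuals, is measurable (with respect to the completed product measure
in the case of sequences). All discrete probability measures are of this kind. -/
def IsDistribution (μ : Measure X) : Prop :=
  IsProbabilityMeasure μ ∧
    ∀ (n : ℕ) (s : Set (Fin n → X)), NullMeasurableSet s (Measure.pi fun _ : Fin n => μ)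

/-- The Bernoulli distribution with mean `r` on the outcomes. -/
noncomputable def ber (r : Set.Icc (0 : ℝ) 1) : Measure Bool :=
  ENNReal.ofReal (r : ℝ) • Measure.dirac true + ENNReal.ofReal (1 - (r : ℝ)) • Measure.dirac false

/-- The Markov kernel `x ↦ Ber(p(x))`. -/
noncomputable def outcomeKernel (p : Predictor X) : Kernel X Bool where
  toFun x := ber (p x)
  measurable' := Measurable.of_discrete

/-- The law `μ_p` of the pair `(x, o)` with `x ∼ μ` and `o ∼ Ber(p(x))`. -/
noncomputable def exampleLaw (μ : Measure X) (p : Predictor X) : Measure (X × Bool) :=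
  μ ⊗ₘ outcomeKernel p

/-- The probability that `d` accepts a random pair drawn from `μ_p`. -/
noncomputable def acceptProb (μ : Measure X) (p : Predictor X) (d : Distinguisher X) : ℝ :=
  ∫ z, (d z.1 z.2 : ℝ) ∂(exampleLaw μ p)

/-- The distinguishing advantage of `d`. -/
noncomputable def adv (μ : Measure X) (d : Distinguisher X) (p q : Predictor X) : ℝ :=
  |acceptProb μ p d - acceptProb μ q d|

/-- The distinguishing advantage of a class `D`. -/
noncomputable def advClass (μ : Measure X) (D : Set (Distinguisher X)) (p q : Predictor X) : ℝ :=
  ⨆ d : D, adv μ d.1 p q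

/-- Randomized learners that take `n` examples: the output predictor is an arbitrary function of
the examples and of a random seed that is independent of the examples. -/
structure Learner (X : Type u) (n : ℕ) where
  Seed : Type
  seedSpace : MeasurableSpace Seed
  seedLaw : Measure Seed
  seedProb : IsProbabilityMeasure seedLaw
  run : (Fin n → X × Bool) → Seed → Predictor X

attribute [instance] Learner.seedSpace Learner.seedProb

/-- The joint law of `n` i.i.d. examples from `μ_p` and the learner's independent seed. -/
noncomputable def Learner.jointLaw {n : ℕ} (A : Learner X n) (μ : Measure X) (p : Predictor X) :
    Measure ((Fin n → X × Bool) × A.Seed) :=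
  (Measure.pi fun _ : Fin n => exampleLaw μ p).prod A.seedLaw

/-- The learners whose output has advantage at most `ε` with probability at least `1 - δ`. As
learners need not be measurable, this says that the failure event has (outer) probability at
most `δ`, equivalently that success contains a measurable event of probability `≥ 1 - δ`. -/
def OI (n : ℕ) (pstar : Predictor X) (D : Set (Distinguisher X)) (ε δ : ℝ) (μ : Measure X) :
    Set (Learner X n) :=
  {A | A.jointLaw μ pstar {z | ¬ advClass μ D (A.run z.1 z.2) pstar ≤ ε} ≤ ENNReal.ofReal δ}

/-- Distribution-specific realizable OI. -/
def DSR (n : ℕ) (P : Set (Predictor X)) (D : Set (Distinguisher X)) (ε δ : ℝ) (μ : Measure X) :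
    Set (Learner X n) :=
  ⋂ pstar ∈ P, OI n pstar D ε δ μ

/-- Distribution-specific agnostic OI. -/
def DSA (n : ℕ) (P : Set (Predictor X)) (D : Set (Distinguisher X)) (ε δ : ℝ) (μ : Measure X) :
    Set (Learner X n) :=
  ⋂ pstar : Predictor X, OI n pstar D ((⨅ p : P, advClass μ D p.1 pstar) + ε) δ μ

/-- Distribution-free realizable OI. -/
def DFR (n : ℕ) (P : Set (Predictor X)) (D : Set (Distinguisher X)) (ε δ : ℝ) :
    Set (Learner X n) :=
  ⋂ μ ∈ {μ : Measure X | IsDistribution μ}, DSR n P D ε δ μ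

/-- Distribution-free agnostic OI. -/
def DFA (n : ℕ) (P : Set (Predictor X)) (D : Set (Distinguisher X)) (ε δ : ℝ) :
    Set (Learner X n) :=
  ⋂ μ ∈ {μ : Measure X | IsDistribution μ}, DSA n P D ε δ μ

/-- The sample complexity of distribution-free realizable OI (`⊤` if no sample size suffices). -/
noncomputable def sampDFR (P : Set (Predictor X)) (D : Set (Distinguisher X)) (ε δ : ℝ) : ℕ∞ :=
  ⨅ n ∈ {n : ℕ | (DFR n P D ε δ).Nonempty}, (n : ℕ∞)

/-- The sample complexity of distribution-free agnostic OI (`⊤` if no sample size suffices). -/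
noncomputable def sampDFA (P : Set (Predictor X)) (D : Set (Distinguisher X)) (ε δ : ℝ) : ℕ∞ :=
  ⨅ n ∈ {n : ℕ | (DFA n P D ε δ).Nonempty}, (n : ℕ∞)

end Learning

/-- The inclusion of the extended natural numbers in the extended real numbers. -/
noncomputable def toER (n : ℕ∞) : EReal := ((n : ENNReal) : EReal)

end OutcomeInd

/-!
The lower bound is a counting argument. Let `x` be a sequence of length `m` shattered at scale `12 ε`,
let `μ` be uniform on it, and let `p*` be a deterministic predictor given by `m` random bits. Two such
predictors whose bits differ in more than `m / 6` places are told apart by `D` with advantage more than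
`2 ε`: add up the two members of `D` that realize opposite sign patterns on the differing bits
(`six_mul_hammingDist_le`). So one output is correct for at most a Hamming ball of bit vectors, which
has at most `2 ^ (7 m / 8)` elements, while for given individuals and seed there are only `2 ^ n`
outputs. Hence `(1 - δ) 2 ^ m ≤ 2 ^ n 2 ^ (7 m / 8)` (`two_pow_le_of_mem_DFR`).

For the upper bound put `γ = ε / 25` and let `d` be the fat-shattering dimension at scale `γ`.

* Packing. A family of `f_d` that is pairwise separated in the empirical `L¹` distance has at most
  `K ^ log₂ y` members up to a factor `2`, where `K` is polynomial in `1 / ε` and `y` counts the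
  patterns of at most `d` points with levels (`card_lt_of_separated`). Indeed some point and level
  split off two subfamilies that each hold a fraction `1 / K` of the family; the number of shattered
  patterns is superadditive under such a split (`card_shatteredPatterns_add_le`), and it is at most `y`.
  Because the separation is in `L¹` rather than in the supremum distance, `K` does not depend on
  the number of points, which is what avoids a factor `log d` in the end.
* Uniform convergence. By symmetrization with random swaps, a net of `D` in the empirical `L¹`
  distance of a sample of size about `γ⁻² (d log² (2 / ε) + log (2 / δ))` is with high probability a
  net in `L¹(μ)` (`IsDistribution.pi_close_far_le`). The assumption that all sets of finite sequences
  are measurable is what makes Tonelli's theorem available for these events.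
* Boosting. For a finite set `G` of `N` distinguishers, about `γ⁻²` steps of projected gradient descent
  on `∫ (p - p*)²` reach a predictor that no member of `G` distinguishes from `p*` with advantage
  more than `γ`. Only `(3 N) ^ T` predictors can be reached in `T` steps, so a second, independent
  sample suffices to select a good one among them (`pi_selectPredictor_le`). Its size is about
  `γ⁻² T log N`, which gives the factor `ε⁻⁴`.

The learner combines the two samples (`nonempty_DFR`), and `log_packing_le` bounds `log N`. Realizable
and agnostic learning coincide since `p*` itself has advantage `0`.
-/

namespace OutcomeInd

/-! ### Shattered patterns of levels -/

section Patterns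

variable {α ι κ : Type*}

/-- A pattern `P` selects some coordinates and attaches a level `level j` to each of them (the value
`none` marks an unselected coordinate). It is shattered by `F` with margin `γ` if the members of
`F` realize every combination of "above" and "below" the levels on the selected coordinates. -/
def PatternShattered (γ : ℝ) (level : κ → ℝ) (v : α → ι → ℝ) (F : Finset α)
    (P : ι → Option κ) : Prop :=
  ∀ b : ι → Bool, ∃ f ∈ F, ∀ i j, P i = some j →
    (b i = true → level j + γ ≤ v f i) ∧ (b i = false → v f i ≤ level j - γ)

open Classical in
/-- The finite set of all patterns shattered by `F`. -/
noncomputable def shatteredPatterns [Fintype ι] [Fintype κ] (γ : ℝ) (level : κ → ℝ)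
    (v : α → ι → ℝ) (F : Finset α) : Finset (ι → Option κ) :=
  Finset.univ.filter (PatternShattered γ level v F)

lemma PatternShattered.mono {γ : ℝ} {level : κ → ℝ} {v : α → ι → ℝ} {F G : Finset α}
    (hFG : F ⊆ G) {P : ι → Option κ} (h : PatternShattered γ level v F P) :
    PatternShattered γ level v G P := fun b => by
  obtain ⟨f, hf, h'⟩ := h b
  exact ⟨f, hFG hf, h'⟩

/-- Splitting a class at one coordinate `i` into the functions below and the functions above a level
makes the numbers of shattered patterns superadditive: a pattern shattered by both halves does not
use `i`, and may be extended by that level at `i`. -/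
lemma card_shatteredPatterns_add_le [Fintype ι] [Fintype κ] {γ : ℝ} (hγ : 0 < γ)
    {level : κ → ℝ} {v : α → ι → ℝ} {F F₁ F₂ : Finset α} (h₁ : F₁ ⊆ F) (h₂ : F₂ ⊆ F)
    {i : ι} {j : κ} (hl : ∀ f ∈ F₁, v f i ≤ level j - γ) (hu : ∀ f ∈ F₂, level j + γ ≤ v f i) :
    (shatteredPatterns γ level v F₁).card + (shatteredPatterns γ level v F₂).card ≤
      (shatteredPatterns γ level v F).card := by
  classical
  set S := shatteredPatterns γ level v F
  set S₁ := shatteredPatterns γ level v F₁ with hS₁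
  set S₂ := shatteredPatterns γ level v F₂ with hS₂
  have below : ∀ P ∈ S₁, ∀ k, P i = some k → level k < level j := by
    intro P hP k hk
    obtain ⟨f, hf, h⟩ := (Finset.mem_filter.1 hP).2 (fun _ => true)
    linarith [(h i k hk).1 rfl, hl f hf]
  have above : ∀ P ∈ S₂, ∀ k, P i = some k → level j < level k := by
    intro P hP k hk
    obtain ⟨f, hf, h⟩ := (Finset.mem_filter.1 hP).2 (fun _ => false)
    linarith [(h i k hk).2 rfl, hu f hf]
  have none_of : ∀ P ∈ S₁ ∩ S₂, P i = none := by
    intro P hP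
    rw [Finset.mem_inter] at hP
    rcases hk : P i with _ | k
    · rfl
    · exact absurd (below P hP.1 k hk) (above P hP.2 k hk).le.not_gt
  set T := (S₁ ∩ S₂).image (fun P => Function.update P i (some j)) with hT
  have cardT : T.card = (S₁ ∩ S₂).card := by
    refine Finset.card_image_of_injOn ?_
    intro P hP Q hQ hPQ
    funext l
    by_cases hl : l = i
    · subst hl
      rw [none_of P hP, none_of Q hQ]
    · have := congrFun hPQ l
      simpa [Function.update_of_ne hl] using this
  have disj : Disjoint (S₁ ∪ S₂) T := by
    rw [Finset.disjoint_left]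
    intro Q hQ hQT
    obtain ⟨P, -, rfl⟩ := Finset.mem_image.1 hQT
    rcases Finset.mem_union.1 hQ with h | h
    · exact lt_irrefl _ (below _ h j (by simp))
    · exact lt_irrefl _ (above _ h j (by simp))
  have sub : (S₁ ∪ S₂) ∪ T ⊆ S := by
    intro Q hQ
    refine Finset.mem_filter.2 ⟨Finset.mem_univ _, ?_⟩
    rcases Finset.mem_union.1 hQ with h | h
    · rcases Finset.mem_union.1 h with h | h
      · exact (Finset.mem_filter.1 h).2.mono h₁
      · exact (Finset.mem_filter.1 h).2.mono h₂
    · obtain ⟨P, hP, rfl⟩ := Finset.mem_image.1 h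
      have hn := none_of P hP
      rw [Finset.mem_inter] at hP
      intro b
      rcases hb : b i with _ | _
      · obtain ⟨f, hf, h⟩ := (Finset.mem_filter.1 hP.1).2 b
        refine ⟨f, h₁ hf, fun l k hk => ?_⟩
        by_cases hli : l = i
        · subst hli
          obtain rfl : j = k := by simpa using hk
          exact ⟨fun h => by simp [hb] at h, fun _ => hl f hf⟩
        · exact h l k (by simpa [Function.update_of_ne hli] using hk)
      · obtain ⟨f, hf, h⟩ := (Finset.mem_filter.1 hP.2).2 b
        refine ⟨f, h₂ hf, fun l k hk => ?_⟩
        by_cases hli : l = i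
        · subst hli
          obtain rfl : j = k := by simpa using hk
          exact ⟨fun _ => hu f hf, fun h => by simp [hb] at h⟩
        · exact h l k (by simpa [Function.update_of_ne hli] using hk)
  calc S₁.card + S₂.card = (S₁ ∪ S₂).card + (S₁ ∩ S₂).card :=
        (Finset.card_union_add_card_inter _ _).symm
    _ = ((S₁ ∪ S₂) ∪ T).card := by rw [Finset.card_union_of_disjoint disj, cardT]
    _ ≤ S.card := Finset.card_le_card sub

/-- In a family of pairwise separated functions some coordinate and some level split off two
subfamilies, one below and one above the level, that both hold a fixed fraction of the family. Here
separation is in the empirical `L¹` distance, so the fraction does not depend on the number of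
coordinates. -/
lemma exists_balanced_split [Fintype ι] [Fintype κ] {γ : ℝ} (hγ : 0 < γ)
    {level : κ → ℝ} (hlevel : ∀ a c : ℝ, -1 ≤ a → c ≤ 1 → a + 4 * γ ≤ c →
      ∃ j, a ≤ level j - γ ∧ level j + γ ≤ c)
    {v : α → ι → ℝ} (hv : ∀ f i, |v f i| ≤ 1) {F : Finset α} (hF : 2 ≤ F.card)
    (hsep : ∀ f ∈ F, ∀ g ∈ F, f ≠ g →
      21 / 5 * γ * Fintype.card ι < ∑ i, |v f i - v g i|)
    {K : ℕ} (hK0 : 0 < K) (hK : 40 * (Fintype.card κ : ℝ) / γ ≤ K) :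
    ∃ i j, F.card ≤ K * (F.filter fun f => v f i ≤ level j - γ).card ∧
      F.card ≤ K * (F.filter fun f => level j + γ ≤ v f i).card := by
  classical
  by_contra! hcon
  set M : ℝ := (F.card : ℝ) with hM
  set n : ℝ := (Fintype.card ι : ℝ) with hn
  set B : ℝ := (Fintype.card κ : ℝ) with hB
  have hM2 : 2 ≤ M := by rw [hM]; exact_mod_cast hF
  have hn0 : 0 ≤ n := by positivity
  set χ : α → α → ι → ℝ := fun f g i => if v f i + 4 * γ ≤ v g i then 1 else 0 with hχ
  -- Upper bound for the number of separated triples, from the assumed imbalance.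
  have hprod : ∀ i j, (K : ℝ) * (((F.filter fun f => v f i ≤ level j - γ).card : ℝ) *
      ((F.filter fun f => level j + γ ≤ v f i).card : ℝ)) ≤ M * M := by
    intro i j
    have h1 : ((F.filter fun f => v f i ≤ level j - γ).card : ℝ) ≤ M := by
      rw [hM]; exact_mod_cast Finset.card_filter_le _ _
    have h2 : ((F.filter fun f => level j + γ ≤ v f i).card : ℝ) ≤ M := by
      rw [hM]; exact_mod_cast Finset.card_filter_le _ _
    by_cases h : F.card ≤ K * (F.filter fun f => v f i ≤ level j - γ).card
    · have h3 : (K : ℝ) * ((F.filter fun f => level j + γ ≤ v f i).card : ℝ) ≤ M := by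
        rw [hM]; exact_mod_cast (hcon i j h).le
      calc _ = ((F.filter fun f => v f i ≤ level j - γ).card : ℝ) *
            ((K : ℝ) * ((F.filter fun f => level j + γ ≤ v f i).card : ℝ)) := by ring
        _ ≤ M * M := by gcongr
    · have h3 : (K : ℝ) * ((F.filter fun f => v f i ≤ level j - γ).card : ℝ) ≤ M := by
        rw [hM]; exact_mod_cast (not_le.1 h).le
      calc _ = (K : ℝ) * ((F.filter fun f => v f i ≤ level j - γ).card : ℝ) *
            ((F.filter fun f => level j + γ ≤ v f i).card : ℝ) := by ring
        _ ≤ M * M := by gcongr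
  have hpt : ∀ f g i, χ f g i ≤ ∑ j, (if v f i ≤ level j - γ then (1 : ℝ) else 0) *
      (if level j + γ ≤ v g i then (1 : ℝ) else 0) := by
    intro f g i
    have hnn : ∀ j ∈ (Finset.univ : Finset κ), 0 ≤ (if v f i ≤ level j - γ then (1 : ℝ) else 0) *
        (if level j + γ ≤ v g i then (1 : ℝ) else 0) := by
      intro j _; split_ifs <;> simp
    simp only [hχ]
    split_ifs with h
    · obtain ⟨j, h1, h2⟩ := hlevel (v f i) (v g i) (abs_le.1 (hv f i)).1 (abs_le.1 (hv g i)).2 h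
      calc (1 : ℝ) = (if v f i ≤ level j - γ then (1 : ℝ) else 0) *
            (if level j + γ ≤ v g i then (1 : ℝ) else 0) := by simp [h1, h2]
        _ ≤ _ := Finset.single_le_sum hnn (Finset.mem_univ j)
    · exact Finset.sum_nonneg hnn
  set S : ℝ := ∑ f ∈ F, ∑ g ∈ F, ∑ i, χ f g i with hS
  have hupper : (K : ℝ) * S ≤ n * B * (M * M) := by
    have e1 : S ≤ ∑ i, ∑ j, ((F.filter fun f => v f i ≤ level j - γ).card : ℝ) *
        ((F.filter fun f => level j + γ ≤ v f i).card : ℝ) := by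
      calc S ≤ ∑ f ∈ F, ∑ g ∈ F, ∑ i, ∑ j, (if v f i ≤ level j - γ then (1 : ℝ) else 0) *
            (if level j + γ ≤ v g i then (1 : ℝ) else 0) := by
              exact Finset.sum_le_sum fun f _ => Finset.sum_le_sum fun g _ =>
                Finset.sum_le_sum fun i _ => hpt f g i
        _ = ∑ i, ∑ j, ∑ f ∈ F, ∑ g ∈ F, (if v f i ≤ level j - γ then (1 : ℝ) else 0) *
            (if level j + γ ≤ v g i then (1 : ℝ) else 0) := by
              have : ∀ f ∈ F, (∑ g ∈ F, ∑ i, ∑ j, (if v f i ≤ level j - γ then (1 : ℝ) else 0) *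
                  (if level j + γ ≤ v g i then (1 : ℝ) else 0)) = ∑ i, ∑ j, ∑ g ∈ F,
                  (if v f i ≤ level j - γ then (1 : ℝ) else 0) *
                  (if level j + γ ≤ v g i then (1 : ℝ) else 0) := by
                intro f _
                rw [Finset.sum_comm]
                exact Finset.sum_congr rfl fun i _ => Finset.sum_comm
              rw [Finset.sum_congr rfl this, Finset.sum_comm]
              exact Finset.sum_congr rfl fun i _ => Finset.sum_comm
        _ = _ := by
              refine Finset.sum_congr rfl fun i _ => Finset.sum_congr rfl fun j _ => ?_
              rw [← Finset.sum_mul_sum]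
              simp
    calc (K : ℝ) * S ≤ K * ∑ i, ∑ j, ((F.filter fun f => v f i ≤ level j - γ).card : ℝ) *
        ((F.filter fun f => level j + γ ≤ v f i).card : ℝ) := by gcongr
      _ = ∑ i, ∑ j, (K : ℝ) * (((F.filter fun f => v f i ≤ level j - γ).card : ℝ) *
        ((F.filter fun f => level j + γ ≤ v f i).card : ℝ)) := by simp only [Finset.mul_sum]
      _ ≤ ∑ i : ι, ∑ j : κ, M * M := 
            Finset.sum_le_sum fun i _ => Finset.sum_le_sum fun j _ => hprod i j
      _ = n * B * (M * M) := by simp [hn, hB]; ring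
  -- Lower bound, from the separation.
  have hpair : ∀ f ∈ F, ∀ g ∈ F, f ≠ g → γ * n / 10 < ∑ i, (χ f g i + χ g f i) := by
    intro f hf g hg hfg
    have h1 := hsep f hf g hg hfg
    have h2 : ∑ i, |v f i - v g i| ≤ ∑ i, (4 * γ + 2 * (χ f g i + χ g f i)) := by
      gcongr with i _
      have hf' := abs_le.1 (hv f i)
      have hg' := abs_le.1 (hv g i)
      simp only [hχ]
      rw [abs_le]
      split_ifs <;> constructor <;> linarith
    rw [Finset.sum_add_distrib, ← Finset.mul_sum, Finset.sum_const, Finset.card_univ,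
      nsmul_eq_mul] at h2
    rw [← Finset.mul_sum, ← hn] at h2
    nlinarith
  have hsym : ∑ f ∈ F, ∑ g ∈ F, ∑ i, (χ f g i + χ g f i) = 2 * S := by
    have : ∑ f ∈ F, ∑ g ∈ F, ∑ i, χ g f i = S := by rw [hS, Finset.sum_comm]
    simp only [Finset.sum_add_distrib]
    rw [this]
    ring
  have hχ0 : ∀ f g i, 0 ≤ χ f g i := by intro f g i; simp only [hχ]; split_ifs <;> simp
  have hlower : M * ((M - 1) * (γ * n / 10)) < 2 * S := by
    rw [← hsym]
    have : ∀ f ∈ F, (M - 1) * (γ * n / 10) < ∑ g ∈ F, ∑ i, (χ f g i + χ g f i) := by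
      intro f hf
      have hne : (F.erase f).Nonempty := by
        rw [← Finset.card_pos, Finset.card_erase_of_mem hf]; omega
      calc (M - 1) * (γ * n / 10) = ∑ g ∈ F.erase f, γ * n / 10 := by
            rw [Finset.sum_const, Finset.card_erase_of_mem hf, nsmul_eq_mul, hM,
              Nat.cast_sub (by omega)]
            simp
        _ < ∑ g ∈ F.erase f, ∑ i, (χ f g i + χ g f i) := by
            refine Finset.sum_lt_sum_of_nonempty hne fun g hg => ?_
            rw [Finset.mem_erase] at hg
            exact hpair f hf g hg.2 hg.1.symm
        _ ≤ _ := Finset.sum_le_sum_of_subset_of_nonneg (Finset.erase_subset _ _)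
            fun g _ _ => Finset.sum_nonneg fun i _ => add_nonneg (hχ0 _ _ _) (hχ0 _ _ _)
    calc M * ((M - 1) * (γ * n / 10)) = ∑ f ∈ F, (M - 1) * (γ * n / 10) := by
          rw [Finset.sum_const, nsmul_eq_mul]
      _ < _ := Finset.sum_lt_sum_of_nonempty (Finset.card_pos.1 (by omega)) this
  have hS0 : M * M * (γ * n) / 40 < S := by
    have : 0 ≤ M * (M - 2) * (γ * n) :=
      mul_nonneg (mul_nonneg (by linarith) (by linarith)) (by positivity)
    nlinarith
  have hKγ : 40 * B ≤ K * γ := by rwa [div_le_iff₀ hγ] at hK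
  have : n * B * (M * M) < K * S := by
    calc n * B * (M * M) ≤ K * (M * M * (γ * n) / 40) := by
          nlinarith [mul_le_mul_of_nonneg_left hKγ (show 0 ≤ n * (M * M) by positivity)]
      _ < K * S := by gcongr
  linarith

/-- Iterating the balanced split: a large separated family shatters exponentially many patterns. -/
lemma two_pow_le_card_shatteredPatterns [Fintype ι] [Fintype κ] {γ : ℝ} (hγ : 0 < γ)
    {level : κ → ℝ} (hlevel : ∀ a c : ℝ, -1 ≤ a → c ≤ 1 → a + 4 * γ ≤ c →
      ∃ j, a ≤ level j - γ ∧ level j + γ ≤ c)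
    {v : α → ι → ℝ} (hv : ∀ f i, |v f i| ≤ 1)
    {K : ℕ} (hK0 : 0 < K) (hK : 40 * (Fintype.card κ : ℝ) / γ ≤ K) (k : ℕ) :
    ∀ F : Finset α, 2 * K ^ k ≤ F.card →
    (∀ f ∈ F, ∀ g ∈ F, f ≠ g → 21 / 5 * γ * Fintype.card ι < ∑ i, |v f i - v g i|) →
    2 ^ (k + 1) ≤ (shatteredPatterns γ level v F).card := by
  classical
  induction k with
  | zero =>
    intro F hF hsep
    obtain ⟨i, j, h1, h2⟩ := exists_balanced_split hγ hlevel hv (by simpa using hF) hsep hK0 hK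
    have one_le : ∀ G : Finset α, F.card ≤ K * G.card →
        1 ≤ (shatteredPatterns γ level v G).card := by
      intro G hG
      have : G.Nonempty := by
        rw [← Finset.card_pos]
        by_contra h0
        simp only [not_lt, nonpos_iff_eq_zero] at h0
        rw [h0] at hG
        simp only [pow_zero] at hF
        omega
      obtain ⟨g, hg⟩ := this
      refine Finset.card_pos.2 ⟨fun _ => none, Finset.mem_filter.2 ⟨Finset.mem_univ _, ?_⟩⟩
      exact fun b => ⟨g, hg, fun i j h => by simp at h⟩
    have := card_shatteredPatterns_add_le hγ (v := v) (F := F) (Finset.filter_subset _ _)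
      (Finset.filter_subset _ _) (i := i) (j := j)
      (F₁ := F.filter fun f => v f i ≤ level j - γ) (F₂ := F.filter fun f => level j + γ ≤ v f i)
      (fun f hf => (Finset.mem_filter.1 hf).2) (fun f hf => (Finset.mem_filter.1 hf).2)
    have a := one_le _ h1
    have b := one_le _ h2
    simp only [zero_add, pow_one]
    omega
  | succ k ih =>
    intro F hF hsep
    have hF2 : 2 ≤ F.card := le_trans (by
      have := Nat.pow_pos (n := k + 1) hK0
      omega) hF
    obtain ⟨i, j, h1, h2⟩ := exists_balanced_split hγ hlevel hv hF2 hsep hK0 hK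
    have big : ∀ G : Finset α, G ⊆ F → F.card ≤ K * G.card →
        2 ^ (k + 1) ≤ (shatteredPatterns γ level v G).card := by
      intro G hGF hG
      refine ih G ?_ fun f hf g hg => hsep f (hGF hf) g (hGF hg)
      have : K * (2 * K ^ k) ≤ K * G.card := by
        calc K * (2 * K ^ k) = 2 * K ^ (k + 1) := by ring
          _ ≤ _ := hF.trans hG
      exact Nat.le_of_mul_le_mul_left this hK0
    have := card_shatteredPatterns_add_le hγ (v := v) (F := F) (Finset.filter_subset _ _)
      (Finset.filter_subset _ _) (i := i) (j := j)
      (F₁ := F.filter fun f => v f i ≤ level j - γ) (F₂ := F.filter fun f => level j + γ ≤ v f i)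
      (fun f hf => (Finset.mem_filter.1 hf).2) (fun f hf => (Finset.mem_filter.1 hf).2)
    have a := big _ (Finset.filter_subset _ _) h1
    have b := big _ (Finset.filter_subset _ _) h2
    rw [pow_succ]
    omega

end Patterns

/-- A bound on the number of patterns that select at most `d` coordinates: give each selected
coordinate the weight `l` and sum the weights of all patterns, which factorizes. -/
lemma card_patterns_mul_pow_le {ι κ : Type*} [Fintype ι] [Fintype κ] [DecidableEq ι]
    [DecidableEq κ] (d : ℕ) {l : ℝ} (hl0 : 0 ≤ l) (hl1 : l ≤ 1) :
    (((Finset.univ : Finset (ι → Option κ)).filter fun P =>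
      (Finset.univ.filter fun i => P i ≠ none).card ≤ d).card : ℝ) * l ^ d ≤
      (1 + Fintype.card κ * l) ^ Fintype.card ι := by
  set w : Option κ → ℝ := fun o => if o ≠ none then l else 1 with hw
  have hw0 : ∀ o, 0 ≤ w o := by intro o; simp only [hw]; split_ifs <;> simp [hl0]
  have h1 : ∑ P : ι → Option κ, ∏ i, w (P i) = (1 + Fintype.card κ * l) ^ Fintype.card ι := by
    have h := Finset.prod_univ_sum (fun _ : ι => (Finset.univ : Finset (Option κ)))
      (fun _ o => w o)
    rw [Fintype.piFinset_univ] at h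
    rw [← h]
    simp [Fintype.sum_option, hw]
  rw [← h1, ← nsmul_eq_mul, ← Finset.sum_const]
  refine (Finset.sum_le_sum ?_).trans (Finset.sum_le_sum_of_subset_of_nonneg
    (Finset.filter_subset _ _) fun P _ _ => Finset.prod_nonneg fun i _ => hw0 _)
  intro P hP
  simp only [hw]
  rw [Finset.prod_ite]
  simp only [Finset.prod_const, one_pow, mul_one]
  exact pow_le_pow_of_le_one hl0 hl1 (Finset.mem_filter.1 hP).2

lemma le_fat_of_fatShattered {X : Type*} {F : Set (X → ℝ)} {γ : ℝ} {n : ℕ} {x : Fin n → X}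
    (h : FatShattered F γ x) : (n : ℕ∞) ≤ fat F γ :=
  le_iSup₂_of_le (f := fun (n : ℕ) (_ : n ∈ {n : ℕ | ∃ x : Fin n → X, FatShattered F γ x}) =>
    (n : ℕ∞)) n ⟨x, h⟩ le_rfl

lemma Distinguisher.abs_toFun_le_one {X : Type*} (d : Distinguisher X) (x : X) :
    |d.toFun x| ≤ 1 := by
  have h1 := (d x true).2
  have h2 := (d x false).2
  simp only [Distinguisher.toFun]
  rw [abs_le]
  constructor <;> linarith [h1.1, h1.2, h2.1, h2.2]

/-- A pattern shattered by distinguishers from `D` selects a fat-shattered sequence. -/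
lemma card_support_le_of_patternShattered {X ι κ : Type*} [Fintype ι] [DecidableEq κ]
    {D : Set (Distinguisher X)}
    {γ : ℝ} {d : ℕ} (hd : fat (functionClass D) γ ≤ d) {level : κ → ℝ} {z : ι → X}
    {F : Finset (Distinguisher X)} (hF : ↑F ⊆ D) {P : ι → Option κ}
    (hP : PatternShattered γ level (fun f i => f.toFun (z i)) F P) :
    (Finset.univ.filter fun i => P i ≠ none).card ≤ d := by
  classical
  set A := Finset.univ.filter fun i => P i ≠ none with hA
  set e := A.equivFin
  have hsome : ∀ i : A, ∃ j, P i = some j := fun i =>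
    Option.ne_none_iff_exists'.1 (Finset.mem_filter.1 i.2).2
  choose s hs using hsome
  have key : FatShattered (functionClass D) γ (fun i => z (e.symm i)) := by
    refine ⟨fun i => level (s (e.symm i)), fun b hb => ?_⟩
    obtain ⟨f, hf, h⟩ := hP (fun i => if hi : i ∈ A then decide (b (e ⟨i, hi⟩) = 1) else true)
    refine ⟨f.toFun, ⟨f, hF hf, rfl⟩, fun i => ?_⟩
    have h' := h (e.symm i) (s (e.symm i)) (hs _)
    simp only [Subtype.coe_eta, Finset.coe_mem, dif_pos, Equiv.apply_symm_apply,
      decide_eq_true_eq, decide_eq_false_iff_not] at h'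
    rcases hb i with hi | hi
    · have := h'.2 (by rw [hi]; norm_num)
      rw [hi]; linarith
    · have := h'.1 hi
      rw [hi]; linarith
  exact_mod_cast (le_fat_of_fatShattered key).trans hd

/-- The number of patterns on `n` coordinates with `B` levels that select at most `d` of them. -/
noncomputable def patternCount (n B d : ℕ) : ℕ :=
  ((Finset.univ : Finset (Fin n → Option (Fin B))).filter fun P =>
      (Finset.univ.filter fun i => P i ≠ none).card ≤ d).card

/-- The packing bound: a family of distinguishers that is pairwise separated in the empirical `L¹`
distance is small, in terms of the fat-shattering dimension and the number of points. -/
lemma card_lt_of_separated {X : Type*} {D : Set (Distinguisher X)} {γ : ℝ} (hγ : 0 < γ)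
    {d n : ℕ} (hd : fat (functionClass D) γ ≤ d) {K : ℕ} (hK0 : 0 < K)
    (hK : 40 * (⌈1 / γ⌉₊ : ℝ) / γ ≤ K)
    {ι : Type*} [Fintype ι] (hn : Fintype.card ι = n) (z : ι → X)
    {F : Finset (Distinguisher X)} (hF : ↑F ⊆ D)
    (hsep : ∀ f ∈ F, ∀ g ∈ F, f ≠ g →
      21 / 5 * γ * Fintype.card ι < ∑ i, |f.toFun (z i) - g.toFun (z i)|) :
    F.card < 2 * K ^ Nat.log 2 (patternCount n ⌈1 / γ⌉₊ d) := by
  classical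
  by_contra! hcard
  set B := ⌈1 / γ⌉₊ with hB
  -- Reindex the points by `Fin n`.
  obtain e := Fintype.equivFinOfCardEq hn
  set y : Fin n → X := fun i => z (e.symm i) with hy
  set level : Fin B → ℝ := fun j => -1 + 2 * γ * (j : ℕ) with hlev
  -- The levels form a grid of mesh `2 * γ`, and `[a + γ, c - γ]` is at least that long.
  have hlevel : ∀ a c : ℝ, -1 ≤ a → c ≤ 1 → a + 4 * γ ≤ c →
      ∃ j, a ≤ level j - γ ∧ level j + γ ≤ c := by
    intro a c ha hc hac
    set t : ℝ := (a + 1 + γ) / (2 * γ) with ht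
    have ht0 : 0 ≤ t := by apply div_nonneg <;> linarith
    have hlt : (⌈t⌉₊ : ℝ) < t + 1 := Nat.ceil_lt_add_one ht0
    have hge : t ≤ ⌈t⌉₊ := Nat.le_ceil t
    have hmul : 2 * γ * t = a + 1 + γ := by rw [ht]; field_simp
    have hup : 2 * γ * (⌈t⌉₊ : ℝ) ≤ a + 1 + 3 * γ := by nlinarith
    have hlo : a + 1 + γ ≤ 2 * γ * (⌈t⌉₊ : ℝ) := by nlinarith
    have hjB : ⌈t⌉₊ < B := by
      have : (⌈t⌉₊ : ℝ) < 1 / γ := by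
        rw [lt_div_iff₀ hγ]; nlinarith
      exact_mod_cast this.trans_le (Nat.le_ceil _)
    exact ⟨⟨⌈t⌉₊, hjB⟩, by simp only [hlev]; linarith, by simp only [hlev]; linarith⟩
  have hgrow := two_pow_le_card_shatteredPatterns hγ hlevel
    (v := fun (f : Distinguisher X) i => f.toFun (y i))
    (fun f i => f.abs_toFun_le_one _) hK0 (by simpa using hK) _ F hcard (by
      intro f hf g hg hfg
      have h := hsep f hf g hg hfg
      rw [hn] at h
      rw [Fintype.card_fin]
      calc _ < _ := h
        _ = _ := by
          rw [← Equiv.sum_comp e]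
          simp [hy])
  have hle : (shatteredPatterns γ level (fun (f : Distinguisher X) i => f.toFun (y i)) F).card ≤
      patternCount n B d := by
    refine Finset.card_le_card fun P hP => Finset.mem_filter.2 ⟨Finset.mem_univ _, ?_⟩
    exact card_support_le_of_patternShattered hd hF (Finset.mem_filter.1 hP).2
  exact absurd (hgrow.trans hle) (not_le.2 (Nat.lt_pow_succ_log_self (by norm_num) _))

/-! ### Product measures in which every set is measurable -/

/-- Every set of finite sequences is measurable for the completed product measure. -/
def PowersNullMeasurable {Y : Type*} [MeasurableSpace Y] (ν : Measure Y) : Prop :=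
  ∀ (n : ℕ) (s : Set (Fin n → Y)), NullMeasurableSet s (Measure.pi fun _ : Fin n => ν)

lemma measurePreserving_comp_equiv {Y ι κ : Type*} [MeasurableSpace Y] [Fintype ι] [Fintype κ]
    (ν : Measure Y) [IsProbabilityMeasure ν] (e : ι ≃ κ) :
    MeasurePreserving (MeasurableEquiv.arrowCongr' e (MeasurableEquiv.refl Y))
      (Measure.pi fun _ => ν) (Measure.pi fun _ => ν) :=
  measurePreserving_arrowCongr' (fun _ => ν) (fun _ => ν) e (MeasurableEquiv.refl Y)
    fun _ => MeasurePreserving.id ν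

lemma PowersNullMeasurable.pi {Y ι : Type*} [MeasurableSpace Y] [Fintype ι] {ν : Measure Y}
    [IsProbabilityMeasure ν] (h : PowersNullMeasurable ν) (s : Set (ι → Y)) :
    NullMeasurableSet s (Measure.pi fun _ : ι => ν) := by
  have hp := measurePreserving_comp_equiv ν (Fintype.equivFin ι)
  set T := MeasurableEquiv.arrowCongr' (Fintype.equivFin ι) (MeasurableEquiv.refl Y)
  have := (h _ (T.symm ⁻¹' s)).preimage hp.quasiMeasurePreserving
  rwa [← Set.preimage_comp, T.symm_comp_self, Set.preimage_id] at this

lemma prod_apply_of_nullMeasurableSet {α β : Type*} [MeasurableSpace α] [MeasurableSpace β]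
    {μ : Measure α} {ν : Measure β} [SFinite μ] [SFinite ν] {s : Set (α × β)}
    (hs : NullMeasurableSet s (μ.prod ν)) :
    μ.prod ν s = ∫⁻ x, ν (Prod.mk x ⁻¹' s) ∂μ := by
  obtain ⟨t, -, ht, hts⟩ := hs.exists_measurable_superset_ae_eq
  rw [← measure_congr hts, Measure.prod_apply ht]
  refine lintegral_congr_ae ?_
  filter_upwards [Measure.ae_ae_of_ae_prod hts] with x hx
  exact measure_congr hx

/-- Tonelli's theorem for an arbitrary event about two independent samples. -/
lemma PowersNullMeasurable.pi_sum_apply {Y ι κ : Type*} [MeasurableSpace Y] [Fintype ι]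
    [Fintype κ] {ν : Measure Y} [IsProbabilityMeasure ν] (h : PowersNullMeasurable ν)
    (s : Set (ι ⊕ κ → Y)) :
    Measure.pi (fun _ : ι ⊕ κ => ν) s =
      ∫⁻ x, Measure.pi (fun _ : κ => ν) {y | Sum.elim x y ∈ s} ∂Measure.pi (fun _ : ι => ν) := by
  have hp := measurePreserving_sumPiEquivProdPi_symm (ι := ι) (ι' := κ) (X := fun _ => Y)
    (fun _ => ν)
  set T := (MeasurableEquiv.sumPiEquivProdPi (fun _ : ι ⊕ κ => Y)).symm with hT
  rw [← hp.measure_preimage_equiv, prod_apply_of_nullMeasurableSet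
    ((h.pi s).preimage hp.quasiMeasurePreserving)]
  refine lintegral_congr fun x => congrArg _ ?_
  ext y
  have : T (x, y) = Sum.elim x y := by
    funext i; cases i <;> rfl
  simp [this]

/-! ### The law of an example -/

lemma abs_predictor_sub_le_one {X : Type*} (p q : Predictor X) (x : X) : |(p x : ℝ) - q x| ≤ 1 := by
  have h1 := (p x).2
  have h2 := (q x).2
  rw [abs_le]
  constructor <;> linarith [h1.1, h1.2, h2.1, h2.2]

lemma abs_predictor_sub_mul_le_one {X : Type*} (p q : Predictor X) (d : Distinguisher X) (x : X) :
    |((p x : ℝ) - q x) * d.toFun x| ≤ 1 := by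
  rw [abs_mul]
  exact mul_le_one₀ (abs_predictor_sub_le_one p q x) (abs_nonneg _) (d.abs_toFun_le_one x)

section Law

variable {X : Type*} [MeasurableSpace X] [DiscreteMeasurableSpace X]

instance (r : Set.Icc (0 : ℝ) 1) : IsProbabilityMeasure (ber r) := ⟨by
  simp only [ber, Measure.coe_add, Measure.coe_smul, Pi.add_apply, Pi.smul_apply, measure_univ,
    smul_eq_mul, mul_one]
  rw [← ENNReal.ofReal_add r.2.1 (by linarith [r.2.2])]
  simp⟩

instance (p : Predictor X) : IsMarkovKernel (outcomeKernel p) :=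
  ⟨fun x => by change IsProbabilityMeasure (ber (p x)); infer_instance⟩

instance (μ : Measure X) [IsProbabilityMeasure μ] (p : Predictor X) :
    IsProbabilityMeasure (exampleLaw μ p) := by
  unfold exampleLaw; infer_instance

lemma integral_ber (r : Set.Icc (0 : ℝ) 1) (g : Bool → ℝ) :
    ∫ o, g o ∂(ber r) = r * g true + (1 - r) * g false := by
  rw [ber, integral_add_measure, integral_smul_measure, integral_smul_measure, integral_dirac,
    integral_dirac, ENNReal.toReal_ofReal r.2.1, ENNReal.toReal_ofReal (by linarith [r.2.2])]
  · simp
  · exact (Integrable.of_finite).smul_measure ENNReal.ofReal_ne_top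
  · exact (Integrable.of_finite).smul_measure ENNReal.ofReal_ne_top

lemma measurable_of_discrete_prod_bool {Z : Type*} [MeasurableSpace Z] (g : X × Bool → Z) :
    Measurable g :=
  measurable_from_prod_countable_left fun _ => Measurable.of_discrete

lemma integrable_of_abs_le {Y : Type*} [MeasurableSpace Y] {ν : Measure Y} [IsFiniteMeasure ν]
    {g : Y → ℝ} (hg : Measurable g) {c : ℝ} (hc : ∀ y, |g y| ≤ c) : Integrable g ν :=
  Integrable.of_bound hg.aestronglyMeasurable c (Filter.Eventually.of_forall hc)

lemma integral_exampleLaw (μ : Measure X) [IsProbabilityMeasure μ] (p : Predictor X)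
    {g : X × Bool → ℝ} {c : ℝ} (hc : ∀ z, |g z| ≤ c) :
    ∫ z, g z ∂(exampleLaw μ p) = ∫ x, (p x * g (x, true) + (1 - p x) * g (x, false)) ∂μ := by
  rw [exampleLaw, Measure.integral_compProd
    (integrable_of_abs_le (measurable_of_discrete_prod_bool g) hc)]
  exact integral_congr_ae (Filter.Eventually.of_forall fun x => integral_ber (p x) _)

/-- The advantage of `d` is the correlation of `p - q` with the function of `d`. -/
lemma adv_eq (μ : Measure X) [IsProbabilityMeasure μ] (d : Distinguisher X) (p q : Predictor X) :
    adv μ d p q = |∫ x, ((p x : ℝ) - q x) * d.toFun x ∂μ| := by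
  have hb : ∀ z : X × Bool, |(d z.1 z.2 : ℝ)| ≤ 1 := fun z => by
    rw [abs_of_nonneg (d z.1 z.2).2.1]; exact (d z.1 z.2).2.2
  have hint : ∀ p : Predictor X, Integrable
      (fun x => (p x : ℝ) * d x true + (1 - p x) * d x false) μ := fun p => by
    refine integrable_of_abs_le (c := 1) Measurable.of_discrete fun x => ?_
    have h1 := (d x true).2
    have h2 := (d x false).2
    have h3 := (p x).2
    rw [abs_le]
    constructor <;> nlinarith [h1.1, h1.2, h2.1, h2.2, h3.1, h3.2]
  rw [adv, acceptProb, acceptProb, integral_exampleLaw μ p hb, integral_exampleLaw μ q hb,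
    ← integral_sub (hint p) (hint q)]
  congr 1
  refine integral_congr_ae (Filter.Eventually.of_forall fun x => ?_)
  simp only [Distinguisher.toFun]
  ring

lemma adv_le_one (μ : Measure X) [IsProbabilityMeasure μ] (d : Distinguisher X)
    (p q : Predictor X) : adv μ d p q ≤ 1 := by
  rw [adv_eq]
  have := norm_integral_le_of_norm_le_const (μ := μ) (C := 1)
    (f := fun x => ((p x : ℝ) - q x) * d.toFun x)
    (Filter.Eventually.of_forall (abs_predictor_sub_mul_le_one p q d))
  simpa using this

lemma adv_le_advClass (μ : Measure X) [IsProbabilityMeasure μ] {D : Set (Distinguisher X)}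
    {d : Distinguisher X} (hd : d ∈ D) (p q : Predictor X) : adv μ d p q ≤ advClass μ D p q :=
  le_ciSup (f := fun d : D => adv μ d.1 p q) ⟨1, by rintro _ ⟨d, rfl⟩; exact adv_le_one μ d.1 p q⟩
    ⟨d, hd⟩

lemma advClass_le (μ : Measure X) {D : Set (Distinguisher X)} (hD : D.Nonempty)
    {p q : Predictor X} {a : ℝ} (h : ∀ d ∈ D, adv μ d p q ≤ a) : advClass μ D p q ≤ a := by
  have := hD.to_subtype
  exact ciSup_le fun d => h d.1 d.2

lemma advClass_nonneg (μ : Measure X) (D : Set (Distinguisher X)) (p q : Predictor X) :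
    0 ≤ advClass μ D p q :=
  Real.iSup_nonneg fun _ => abs_nonneg _

lemma map_fst_exampleLaw (μ : Measure X) [IsProbabilityMeasure μ] (p : Predictor X) :
    (exampleLaw μ p).map Prod.fst = μ :=
  Measure.fst_compProd μ (outcomeKernel p)

lemma measurePreserving_fst_pi (μ : Measure X) [IsProbabilityMeasure μ] (p : Predictor X) (n : ℕ) :
    MeasurePreserving (fun (z : Fin n → X × Bool) i => (z i).1)
      (Measure.pi fun _ => exampleLaw μ p) (Measure.pi fun _ => μ) :=
  measurePreserving_pi (fun _ => exampleLaw μ p) (fun _ => μ)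
    fun _ => ⟨measurable_fst, map_fst_exampleLaw μ p⟩

/-- Every set of sequences of examples is measurable for the completed law: split it according to
the finitely many outcome sequences. -/
lemma IsDistribution.powersNullMeasurable_exampleLaw {μ : Measure X} (h : IsDistribution μ)
    (p : Predictor X) : PowersNullMeasurable (exampleLaw μ p) := by
  have := h.1
  intro n s
  have hs : s = ⋃ o : Fin n → Bool, ({z | (fun i => (z i).2) = o} ∩
      (fun (z : Fin n → X × Bool) i => (z i).1) ⁻¹' {x | (fun i => (x i, o i)) ∈ s}) := by
    ext z
    simp only [Set.mem_iUnion, Set.mem_inter_iff, Set.mem_ofPred_eq, Set.mem_preimage]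
    constructor
    · intro hz; exact ⟨_, rfl, hz⟩
    · rintro ⟨o, rfl, hz⟩; exact hz
  rw [hs]
  refine NullMeasurableSet.iUnion fun o => NullMeasurableSet.inter ?_
    ((h.2 n _).preimage
      (measurePreserving_fst_pi μ p n).quasiMeasurePreserving)
  have hm : Measurable fun (z : Fin n → X × Bool) i => (z i).2 :=
    measurable_pi_lambda _ fun i => measurable_snd.comp (measurable_pi_apply i)
  exact (hm (measurableSet_singleton o)).nullMeasurableSet

end Law

/-! ### Hoeffding's inequality for samples -/

lemma pi_real_hoeffding {Y ι : Type*} [MeasurableSpace Y] [Fintype ι] (ν : Measure Y)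
    [IsProbabilityMeasure ν] {g : Y → ℝ} (hg : Measurable g) {c : ℝ} (hc : 0 < c)
    (hgc : ∀ y, |g y| ≤ c) {t : ℝ} (ht : 0 ≤ t) :
    (Measure.pi fun _ : ι => ν).real
      {y | Fintype.card ι * t ≤ ∑ i, (g (y i) - ∫ w, g w ∂ν)} ≤
      Real.exp (-(Fintype.card ι * t ^ 2 / (2 * c ^ 2))) := by
  have hind : iIndepFun (fun (i : ι) (y : ι → Y) => g (y i) - ∫ w, g w ∂ν)
      (Measure.pi fun _ : ι => ν) :=
    iIndepFun_pi (X := fun _ w => g w - ∫ w, g w ∂ν) fun _ => (hg.sub_const _).aemeasurable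
  have hsub : ∀ i ∈ (Finset.univ : Finset ι), HasSubgaussianMGF
      (fun (y : ι → Y) => g (y i) - ∫ w, g w ∂ν) ((‖c - -c‖₊ / 2) ^ 2)
      (Measure.pi fun _ : ι => ν) := by
    intro i _
    have hint : ∫ y : ι → Y, g (y i) ∂(Measure.pi fun _ : ι => ν) = ∫ w, g w ∂ν := by
      have := (measurePreserving_eval (fun _ : ι => ν) i)
      conv_rhs => rw [← this.map_eq]
      rw [integral_map this.measurable.aemeasurable hg.aestronglyMeasurable]
    have := hasSubgaussianMGF_of_mem_Icc (μ := Measure.pi fun _ : ι => ν)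
      (X := fun y => g (y i)) (a := -c) (b := c)
      (hg.comp (measurable_pi_apply i)).aemeasurable
      (Filter.Eventually.of_forall fun y => abs_le.1 (hgc _))
    rwa [hint] at this
  refine (HasSubgaussianMGF.measure_sum_ge_le_of_iIndepFun hind hsub
    (ε := Fintype.card ι * t) (by positivity)).trans (Real.exp_le_exp.2 (le_of_eq ?_))
  simp only [Finset.sum_const, Finset.card_univ, nsmul_eq_mul, NNReal.coe_mul, NNReal.coe_natCast,
    NNReal.coe_pow, NNReal.coe_div, coe_nnnorm, NNReal.coe_ofNat]
  rw [show c - -c = 2 * c by ring, Real.norm_of_nonneg (by positivity)]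
  rcases eq_or_ne (Fintype.card ι : ℝ) 0 with h | h
  · simp [h]
  · field_simp

/-! ### Symmetrization -/

/-- Hoeffding's inequality for a sum with random signs, as a count of sign patterns. -/
lemma card_signs_le {ι : Type*} [Fintype ι] [DecidableEq ι] {a : ι → ℝ} (ha : ∀ i, |a i| ≤ 2)
    {s : ℝ} (hs : 0 ≤ s) :
    ((Finset.univ.filter fun σ : ι → Bool =>
      Fintype.card ι * s ≤ ∑ i, if σ i then -a i else a i).card : ℝ) ≤
      2 ^ Fintype.card ι * Real.exp (-(Fintype.card ι * s ^ 2 / 8)) := by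
  set n := Fintype.card ι
  -- The exponential moment with the optimal parameter `s / 4`.
  have hsum : ∑ σ : ι → Bool, Real.exp (s / 4 * ∑ i, if σ i then -a i else a i) ≤
      2 ^ n * Real.exp (n * s ^ 2 / 8) := by
    have h := Finset.prod_univ_sum (fun _ : ι => (Finset.univ : Finset Bool))
      (fun i o => Real.exp (s / 4 * if o then -a i else a i))
    rw [Fintype.piFinset_univ] at h
    calc ∑ σ : ι → Bool, Real.exp (s / 4 * ∑ i, if σ i then -a i else a i)
        = ∑ σ : ι → Bool, ∏ i, Real.exp (s / 4 * if σ i then -a i else a i) := by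
          refine Finset.sum_congr rfl fun σ _ => ?_
          rw [Finset.mul_sum, Real.exp_sum]
      _ = ∏ i, (2 * Real.cosh (s / 4 * a i)) := by
          rw [← h]
          refine Finset.prod_congr rfl fun i _ => ?_
          rw [Real.cosh_eq]
          simp
          ring
      _ ≤ ∏ i : ι, (2 * Real.exp (s ^ 2 / 8)) := by
          refine Finset.prod_le_prod (fun i _ => by positivity) fun i _ => ?_
          have h1 := Real.cosh_le_exp_half_sq (s / 4 * a i)
          have h2 : (a i) ^ 2 ≤ 4 := by
            have := sq_le_sq' (neg_le_of_abs_le (ha i)) (le_of_abs_le (ha i))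
            linarith
          have h3 : (s / 4 * a i) ^ 2 / 2 ≤ s ^ 2 / 8 := by
            nlinarith [mul_le_mul_of_nonneg_left h2 (sq_nonneg s)]
          linarith [Real.exp_le_exp.2 h3]
      _ = 2 ^ n * Real.exp (n * s ^ 2 / 8) := by
          rw [Finset.prod_const, Finset.card_univ, mul_pow, ← Real.exp_nat_mul]
          congr 2
          ring
  have hmarkov : ((Finset.univ.filter fun σ : ι → Bool =>
      n * s ≤ ∑ i, if σ i then -a i else a i).card : ℝ) * Real.exp (s / 4 * (n * s)) ≤
      ∑ σ : ι → Bool, Real.exp (s / 4 * ∑ i, if σ i then -a i else a i) := by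
    rw [← nsmul_eq_mul, ← Finset.sum_const]
    refine (Finset.sum_le_sum fun σ hσ => ?_).trans (Finset.sum_le_sum_of_subset_of_nonneg
      (Finset.filter_subset _ _) fun σ _ _ => (Real.exp_pos _).le)
    exact Real.exp_le_exp.2 (mul_le_mul_of_nonneg_left (Finset.mem_filter.1 hσ).2 (by linarith))
  have h := hmarkov.trans hsum
  rw [← le_div_iff₀ (Real.exp_pos _), mul_div_assoc, ← Real.exp_sub] at h
  refine h.trans (le_of_eq ?_)
  congr 2
  ring

/-- The permutation of a double index set that swaps the two copies of `i` whenever `σ i`. -/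
def swapPerm {ι : Type*} (σ : ι → Bool) : Equiv.Perm (ι ⊕ ι) :=
  Function.Involutive.toPerm
    (Sum.elim (fun i => if σ i then Sum.inr i else Sum.inl i)
      (fun i => if σ i then Sum.inl i else Sum.inr i)) (by
    rintro (i | i) <;> cases h : σ i <;> simp [h])

@[simp] lemma swapPerm_inl {ι : Type*} (σ : ι → Bool) (i : ι) :
    swapPerm σ (.inl i) = if σ i then .inr i else .inl i := rfl

@[simp] lemma swapPerm_inr {ι : Type*} (σ : ι → Bool) (i : ι) :
    swapPerm σ (.inr i) = if σ i then .inl i else .inr i := rfl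

open Classical in
/-- An event about a double sample is as likely as the largest fraction of random swaps that can
bring a fixed double sample into it. -/
lemma PowersNullMeasurable.pi_le_of_card_swaps_le {Y ι : Type*} [MeasurableSpace Y] [Fintype ι]
    {ν : Measure Y} [IsProbabilityMeasure ν] (h : PowersNullMeasurable ν)
    (E : Set (ι ⊕ ι → Y)) {c : ℝ}
    (hc : ∀ z : ι ⊕ ι → Y, ((Finset.univ.filter fun σ : ι → Bool => z ∘ swapPerm σ ∈ E).card : ℝ) ≤
      2 ^ Fintype.card ι * c) :
    Measure.pi (fun _ : ι ⊕ ι => ν) E ≤ ENNReal.ofReal c := by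
  set P := Measure.pi (fun _ : ι ⊕ ι => ν) with hP
  have hinv : ∀ σ : ι → Bool, P {z | z ∘ swapPerm σ ∈ E} = P E := by
    intro σ
    have := measurePreserving_comp_equiv ν (swapPerm σ).symm
    rw [← this.measure_preimage_equiv E]
    rfl
  have hsum : (2 : ENNReal) ^ Fintype.card ι * P E ≤
      2 ^ Fintype.card ι * ENNReal.ofReal c := by
    calc (2 : ENNReal) ^ Fintype.card ι * P E = ∑ σ : ι → Bool, P {z | z ∘ swapPerm σ ∈ E} := by
          simp [hinv]
      _ = ∑ σ : ι → Bool, ∫⁻ z, Set.indicator {z | z ∘ swapPerm σ ∈ E} 1 z ∂P := by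
          refine Finset.sum_congr rfl fun σ _ => ?_
          rw [lintegral_indicator_one₀ (h.pi _)]
      _ = ∫⁻ z, ∑ σ : ι → Bool, Set.indicator {z | z ∘ swapPerm σ ∈ E} 1 z ∂P := by
          rw [lintegral_finsetSum']
          intro σ _
          exact AEMeasurable.indicator₀ aemeasurable_const (h.pi _)
      _ ≤ ∫⁻ z, 2 ^ Fintype.card ι * ENNReal.ofReal c ∂P := by
          refine lintegral_mono fun z => ?_
          have : ∑ σ : ι → Bool, Set.indicator {z | z ∘ swapPerm σ ∈ E} (1 : (ι ⊕ ι → Y) → ENNReal) z =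
              ((Finset.univ.filter fun σ : ι → Bool => z ∘ swapPerm σ ∈ E).card : ENNReal) := by
            simp [Set.indicator_apply]
          rw [this]
          have h2 : (2 : ENNReal) ^ Fintype.card ι = ENNReal.ofReal (2 ^ Fintype.card ι) := by
            rw [ENNReal.ofReal_pow (by norm_num)]; simp
          rw [h2, ← ENNReal.ofReal_mul (by positivity), ← ENNReal.ofReal_natCast]
          exact ENNReal.ofReal_le_ofReal (hc z)
      _ = _ := by simp [hP]
  exact (ENNReal.mul_le_mul_iff_right (by positivity) (by simp)).1 hsum

/-- If packings are bounded in size, then a largest packing is a net. -/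
lemma exists_net {α : Type*} {D : Set α} {R : α → α → Prop} (hsymm : ∀ a b, R a b → R b a)
    (hirr : ∀ a, ¬ R a a) {N : ℕ}
    (hN : ∀ F : Finset α, ↑F ⊆ D → (∀ f ∈ F, ∀ g ∈ F, f ≠ g → R f g) → F.card ≤ N) :
    ∃ G : Finset α, ↑G ⊆ D ∧ G.card ≤ N ∧ ∀ d ∈ D, ∃ g ∈ G, ¬ R d g := by
  classical
  set S : Set ℕ := {m | ∃ F : Finset α, ↑F ⊆ D ∧ (∀ f ∈ F, ∀ g ∈ F, f ≠ g → R f g) ∧ F.card = m}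
    with hS
  have hbdd : BddAbove S := ⟨N, by rintro _ ⟨F, h1, h2, rfl⟩; exact hN F h1 h2⟩
  obtain ⟨G, hGD, hGsep, hGcard⟩ := Nat.sSup_mem (s := S) ⟨0, ∅, by simp⟩ hbdd
  refine ⟨G, hGD, hN G hGD hGsep, fun d hd => ?_⟩
  by_contra! hall
  have hdG : d ∉ G := fun h => hirr d (hall d h)
  have : (insert d G).card ∈ S := by
    refine ⟨insert d G, ?_, ?_, rfl⟩
    · rw [Finset.coe_insert]
      exact Set.insert_subset hd hGD
    · intro f hf g hg hfg
      rcases Finset.mem_insert.1 hf with hfd | hf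
      · rcases Finset.mem_insert.1 hg with hgd | hg
        · exact absurd (hfd.trans hgd.symm) hfg
        · exact hfd ▸ hall g hg
      · rcases Finset.mem_insert.1 hg with hgd | hg
        · exact hgd ▸ hsymm _ _ (hall f hf)
        · exact hGsep f hf g hg hfg
  have := le_csSup hbdd this
  rw [Finset.card_insert_of_notMem hdG] at this
  omega

/-- Separation of two distinguishers in the empirical `L¹` distance on the points `z`. The threshold
`21 / 5 * γ` exceeds `4 * γ` because separated functions must differ by `4 * γ` on a positive fraction
of the points; five times it is `23 * γ - 2 * γ`. -/
def Separated {X ι : Type*} [Fintype ι] (γ : ℝ) (z : ι → X) (f g : Distinguisher X) : Prop :=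
  21 / 5 * γ * Fintype.card ι < ∑ i, |f.toFun (z i) - g.toFun (z i)|

/-- All packings of `D` on the points `z` have at most `N` elements. -/
def PackingLE {X ι : Type*} [Fintype ι] (D : Set (Distinguisher X)) (γ : ℝ) (N : ℕ)
    (z : ι → X) : Prop :=
  ∀ F : Finset (Distinguisher X), ↑F ⊆ D →
    (∀ f ∈ F, ∀ g ∈ F, f ≠ g → Separated γ z f g) → F.card ≤ N

lemma PackingLE.exists_net {X ι : Type*} [Fintype ι] {D : Set (Distinguisher X)} {γ : ℝ}
    (hγ : 0 < γ) {N : ℕ} {z : ι → X} (h : PackingLE D γ N z) :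
    ∃ G : Finset (Distinguisher X), ↑G ⊆ D ∧ G.card ≤ N ∧ ∀ d ∈ D, ∃ g ∈ G,
      ∑ i, |d.toFun (z i) - g.toFun (z i)| ≤ 21 / 5 * γ * Fintype.card ι := by
  obtain ⟨G, h1, h2, h3⟩ := OutcomeInd.exists_net (R := Separated γ z)
    (fun a b hab => by simpa [Separated, abs_sub_comm] using hab)
    (fun a ha => by
      simp only [Separated, sub_self, abs_zero, Finset.sum_const_zero] at ha
      exact absurd ha (not_lt.2 (by positivity))) h
  exact ⟨G, h1, h2, fun d hd => by simpa [Separated] using h3 d hd⟩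

/-- The double samples on which the distance of some two members of `D` differs much between the
two halves. The threshold is what remains of a distance `23 * γ` in `L¹(μ)` after a loss of `γ` on
the second half and a distance `21 / 5 * γ` on the first half: `89 / 5 = 23 - 1 - 21 / 5`. -/
def distanceGap {X ι : Type*} [Fintype ι] (D : Set (Distinguisher X)) (γ : ℝ) :
    Set (ι ⊕ ι → X) :=
  {z | ∃ d ∈ D, ∃ d' ∈ D, 89 / 5 * γ * Fintype.card ι ≤ ∑ i,
    (|d.toFun (z (.inr i)) - d'.toFun (z (.inr i))| -
      |d.toFun (z (.inl i)) - d'.toFun (z (.inl i))|)}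

open Classical in
/-- For a fixed double sample, few swaps give two members of `D` distances that differ much between
the two halves. The members of `D` are first replaced by those of a net, which costs
`4 * (21 / 5) * γ` and leaves a gap of `γ` for Hoeffding's inequality. -/
lemma card_swaps_le {X ι : Type*} [Fintype ι] {D : Set (Distinguisher X)} {γ : ℝ}
    (hγ : 0 < γ) {N : ℕ} {z : ι ⊕ ι → X} (h : PackingLE D γ N z) :
    ((Finset.univ.filter fun σ : ι → Bool => z ∘ swapPerm σ ∈ distanceGap D γ).card : ℝ) ≤
      2 ^ Fintype.card ι * (N ^ 2 * Real.exp (-(Fintype.card ι * γ ^ 2 / 8))) := by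
  obtain ⟨G, hGD, hGN, hnet⟩ := h.exists_net hγ
  set n : ℝ := (Fintype.card ι : ℝ) with hn
  set w : Distinguisher X → Distinguisher X → ι ⊕ ι → ℝ :=
    fun d d' i => |d.toFun (z i) - d'.toFun (z i)| with hw
  set a : Distinguisher X → Distinguisher X → ι → ℝ :=
    fun d d' i => w d d' (.inr i) - w d d' (.inl i) with ha
  have hw0 : ∀ d d' i, 0 ≤ w d d' i := fun d d' i => abs_nonneg _
  have hw2 : ∀ d d' i, w d d' i ≤ 2 := fun d d' i => by
    have h1 := abs_le.1 (d.abs_toFun_le_one (z i))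
    have h2 := abs_le.1 (d'.abs_toFun_le_one (z i))
    simp only [hw]
    rw [abs_le]
    constructor <;> linarith
  have hswap : ∀ (σ : ι → Bool) d d', ∑ i,
      (|d.toFun (z (swapPerm σ (.inr i))) - d'.toFun (z (swapPerm σ (.inr i)))| -
        |d.toFun (z (swapPerm σ (.inl i))) - d'.toFun (z (swapPerm σ (.inl i)))|) =
      ∑ i, if σ i then -a d d' i else a d d' i := by
    intro σ d d'
    refine Finset.sum_congr rfl fun i _ => ?_
    cases hσ : σ i <;> simp [hσ, ha, hw]
  have hsub : (Finset.univ.filter fun σ : ι → Bool => z ∘ swapPerm σ ∈ distanceGap D γ) ⊆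
      (G ×ˢ G).biUnion fun q => Finset.univ.filter fun σ : ι → Bool =>
        n * γ ≤ ∑ i, if σ i then -a q.1 q.2 i else a q.1 q.2 i := by
    intro σ hσ
    obtain ⟨d, hd, d', hd', hdd⟩ := (Finset.mem_filter.1 hσ).2
    obtain ⟨g, hg, hdg⟩ := hnet d hd
    obtain ⟨g', hg', hdg'⟩ := hnet d' hd'
    refine Finset.mem_biUnion.2 ⟨(g, g'), Finset.mem_product.2 ⟨hg, hg'⟩,
      Finset.mem_filter.2 ⟨Finset.mem_univ _, ?_⟩⟩
    simp only [Function.comp_apply] at hdd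
    rw [hswap] at hdd
    have hpt : ∀ i, (if σ i then -a d d' i else a d d' i) ≤
        (if σ i then -a g g' i else a g g' i) +
        ((w d g (.inl i) + w d' g' (.inl i)) + (w d g (.inr i) + w d' g' (.inr i))) := by
      intro i
      have key : ∀ j, |w d d' j - w g g' j| ≤ w d g j + w d' g' j := by
        intro j
        refine (abs_abs_sub_abs_le_abs_sub _ _).trans ?_
        rw [show d.toFun (z j) - d'.toFun (z j) - (g.toFun (z j) - g'.toFun (z j)) =
          (d.toFun (z j) - g.toFun (z j)) - (d'.toFun (z j) - g'.toFun (z j)) by ring]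
        exact abs_sub _ _
      have h1 := abs_le.1 (key (.inl i))
      have h2 := abs_le.1 (key (.inr i))
      simp only [ha]
      split_ifs <;> linarith
    have htot := Finset.sum_le_sum fun i (_ : i ∈ Finset.univ) => hpt i
    rw [Finset.sum_add_distrib, Finset.sum_add_distrib, Finset.sum_add_distrib,
      Finset.sum_add_distrib] at htot
    rw [Fintype.sum_sum_type, Fintype.card_sum, Nat.cast_add, ← hn] at hdg hdg'
    change _ + ∑ i, w d g (.inr i) ≤ _ at hdg
    change _ + ∑ i, w d' g' (.inr i) ≤ _ at hdg'
    change ∑ i, w d g (.inl i) + _ ≤ _ at hdg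
    change ∑ i, w d' g' (.inl i) + _ ≤ _ at hdg'
    simp only
    linarith
  have hcard : ((Finset.univ.filter fun σ : ι → Bool => z ∘ swapPerm σ ∈ distanceGap D γ).card : ℝ) ≤
      ∑ q ∈ G ×ˢ G, ((Finset.univ.filter fun σ : ι → Bool =>
        n * γ ≤ ∑ i, if σ i then -a q.1 q.2 i else a q.1 q.2 i).card : ℝ) := by
    exact_mod_cast (Finset.card_le_card hsub).trans Finset.card_biUnion_le
  refine hcard.trans ((Finset.sum_le_sum fun q _ => card_signs_le (a := a q.1 q.2) (fun i => ?_)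
    hγ.le).trans ?_)
  · rw [abs_le]
    simp only [ha]
    constructor <;> linarith [hw0 q.1 q.2 (.inl i), hw0 q.1 q.2 (.inr i), hw2 q.1 q.2 (.inl i),
      hw2 q.1 q.2 (.inr i)]
  · rw [Finset.sum_const, Finset.card_product, nsmul_eq_mul, Nat.cast_mul]
    have : (G.card : ℝ) ≤ N := by exact_mod_cast hGN
    calc (G.card : ℝ) * G.card * (2 ^ Fintype.card ι * Real.exp (-(n * γ ^ 2 / 8)))
        ≤ N * N * (2 ^ Fintype.card ι * Real.exp (-(n * γ ^ 2 / 8))) := by gcongr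
      _ = _ := by ring

/-- Empirical nets are nets: with high probability no two members of `D` are close on the sample but
far apart in `L¹(μ)`. -/
lemma IsDistribution.pi_close_far_le {X ι : Type*} [MeasurableSpace X] [DiscreteMeasurableSpace X]
    [Fintype ι] {μ : Measure X} (hμ : IsDistribution μ) {D : Set (Distinguisher X)} {γ : ℝ}
    (hγ : 0 < γ) {N : ℕ} (hN : ∀ z : ι ⊕ ι → X, PackingLE D γ N z)
    (hn : Real.exp (-(Fintype.card ι * γ ^ 2 / 8)) ≤ 1 / 2) :
    Measure.pi (fun _ : ι => μ) {x | ∃ d ∈ D, ∃ d' ∈ D,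
      ∑ i, |d.toFun (x i) - d'.toFun (x i)| ≤ 21 / 5 * γ * Fintype.card ι ∧
      23 * γ < ∫ x, |d.toFun x - d'.toFun x| ∂μ} ≤
      ENNReal.ofReal (2 * N ^ 2 * Real.exp (-(Fintype.card ι * γ ^ 2 / 8))) := by
  classical
  have := hμ.1
  have hμ' : PowersNullMeasurable μ := hμ.2
  set n : ℝ := (Fintype.card ι : ℝ) with hn_def
  set bad := {x : ι → X | ∃ d ∈ D, ∃ d' ∈ D,
      ∑ i, |d.toFun (x i) - d'.toFun (x i)| ≤ 21 / 5 * γ * n ∧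
      23 * γ < ∫ x, |d.toFun x - d'.toFun x| ∂μ}
  set E : Set (ι ⊕ ι → X) := distanceGap D γ with hE_def
  have hE : Measure.pi (fun _ : ι ⊕ ι => μ) E ≤
      ENNReal.ofReal (N ^ 2 * Real.exp (-(n * γ ^ 2 / 8))) :=
    hμ'.pi_le_of_card_swaps_le E fun z => card_swaps_le hγ (hN z)
  -- The second half of the sample sees the large distance with probability at least one half.
  have hghost : ∀ x ∈ bad, (1 / 2 : ENNReal) ≤
      Measure.pi (fun _ : ι => μ) {y | Sum.elim x y ∈ E} := by
    rintro x ⟨d, hd, d', hd', hclose, hfar⟩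
    have hle : ∀ y : X, |(-|d.toFun y - d'.toFun y|)| ≤ 2 := fun y => by
      have h1 := abs_le.1 (d.abs_toFun_le_one y)
      have h2 := abs_le.1 (d'.abs_toFun_le_one y)
      rw [abs_neg, abs_abs, abs_le]
      constructor <;> linarith
    have hoef := pi_real_hoeffding (ι := ι) μ (g := fun y => -|d.toFun y - d'.toFun y|)
      Measurable.of_discrete (c := 2) (by norm_num) hle hγ.le
    set H := {y : ι → X | n * γ ≤ ∑ i, (-|d.toFun (y i) - d'.toFun (y i)| -
      ∫ w, -|d.toFun w - d'.toFun w| ∂μ)} with hH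
    have hHc : Hᶜ ⊆ {y | Sum.elim x y ∈ E} := by
      intro y hy
      refine ⟨d, hd, d', hd', ?_⟩
      simp only [hH, Set.mem_compl_iff, Set.mem_ofPred_eq, not_le, Finset.sum_sub_distrib,
        Finset.sum_neg_distrib, Finset.sum_const, Finset.card_univ, nsmul_eq_mul,
        integral_neg, ← hn_def] at hy
      simp only [Sum.elim_inr, Sum.elim_inl, Finset.sum_sub_distrib]
      have hn0 : 0 ≤ n := by positivity
      nlinarith [mul_le_mul_of_nonneg_left hfar.le hn0]
    have hHm : NullMeasurableSet H (Measure.pi fun _ : ι => μ) := hμ'.pi H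
    have hH2 : (Measure.pi fun _ : ι => μ).real H ≤ 1 / 2 := by
      refine hoef.trans (le_trans (le_of_eq ?_) hn)
      norm_num [hn_def]
    have hHle : Measure.pi (fun _ : ι => μ) H ≤ 1 / 2 := by
      rw [← ENNReal.ofReal_toReal (measure_ne_top (Measure.pi fun _ : ι => μ) H)]
      refine (ENNReal.ofReal_le_ofReal hH2).trans (le_of_eq ?_)
      rw [ENNReal.ofReal_div_of_pos (by norm_num)]
      simp
    refine le_trans ?_ (measure_mono hHc)
    rw [prob_compl_eq_one_sub₀ hHm]
    refine le_trans ?_ (tsub_le_tsub_left hHle 1)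
    rw [one_div, ENNReal.one_sub_inv_two]
  have hhalf : 1 / 2 * Measure.pi (fun _ : ι => μ) bad ≤ Measure.pi (fun _ : ι ⊕ ι => μ) E := by
    rw [hμ'.pi_sum_apply E, ← lintegral_indicator_const₀ (hμ'.pi bad)]
    refine lintegral_mono fun x => ?_
    by_cases hx : x ∈ bad
    · rw [Set.indicator_of_mem hx]
      exact hghost x hx
    · rw [Set.indicator_of_notMem hx]
      exact zero_le
  calc Measure.pi (fun _ : ι => μ) bad = 2 * (1 / 2 * Measure.pi (fun _ : ι => μ) bad) := by
        rw [← mul_assoc, one_div, ENNReal.mul_inv_cancel (by norm_num) (by norm_num), one_mul]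
    _ ≤ 2 * ENNReal.ofReal (N ^ 2 * Real.exp (-(n * γ ^ 2 / 8))) := by
        gcongr
        exact hhalf.trans hE
    _ = _ := by
        rw [mul_assoc (2 : ℝ), ENNReal.ofReal_mul (by norm_num : (0 : ℝ) ≤ 2)]
        simp

/-! ### Boosting over a finite class -/

/-- One boosting step: move `p` along `s * d.toFun` by `η` and project back to `[0,1]`. -/
noncomputable def boostStep {X : Type*} (η : ℝ) (p : Predictor X) (d : Distinguisher X)
    (s : SignType) : Predictor X :=
  fun x => Set.projIcc 0 1 zero_le_one (p x + η * s * d.toFun x)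

open Classical in
/-- The predictors that are reached from `0` by `t` boosting steps with distinguishers from `G`. -/
noncomputable def boostPredictors {X : Type*} (η : ℝ) (G : Finset (Distinguisher X)) :
    ℕ → Finset (Predictor X)
  | 0 => {fun _ => 0}
  | t + 1 => (boostPredictors η G t ×ˢ (G ×ˢ (Finset.univ : Finset SignType))).image
      fun a => boostStep η a.1 a.2.1 a.2.2

lemma card_boostPredictors_le {X : Type*} (η : ℝ) (G : Finset (Distinguisher X)) (t : ℕ) :
    (boostPredictors η G t).card ≤ (3 * G.card) ^ t := by
  classical
  induction t with
  | zero => simp [boostPredictors]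
  | succ t ih =>
    calc (boostPredictors η G (t + 1)).card ≤ _ := Finset.card_image_le
      _ = (boostPredictors η G t).card * (3 * G.card) := by
          rw [Finset.card_product, Finset.card_product, Finset.card_univ,
            show Fintype.card SignType = 3 from rfl, mul_comm G.card]
      _ ≤ (3 * G.card) ^ t * (3 * G.card) := by gcongr
      _ = _ := (pow_succ _ _).symm

lemma boostStep_mem {X : Type*} {η : ℝ} {G : Finset (Distinguisher X)} {t : ℕ} {p : Predictor X}
    (hp : p ∈ boostPredictors η G t) {d : Distinguisher X} (hd : d ∈ G) (s : SignType) :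
    boostStep η p d s ∈ boostPredictors η G (t + 1) := by
  classical
  exact Finset.mem_image.2 ⟨(p, d, s), by simp [hp, hd], rfl⟩

lemma boostStep_zero {X : Type*} (η : ℝ) (p : Predictor X) (d : Distinguisher X) :
    boostStep η p d 0 = p := by
  funext x
  simp [boostStep]

/-- The projection to `[0,1]` only brings the predictor closer to `q`. -/
lemma sq_boostStep_sub_le {X : Type*} (η : ℝ) (p q : Predictor X) (d : Distinguisher X)
    (s : SignType) (x : X) :
    ((boostStep η p d s x : ℝ) - q x) ^ 2 ≤
      ((p x : ℝ) - q x) ^ 2 + 2 * η * s * (((p x : ℝ) - q x) * d.toFun x) + η ^ 2 := by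
  have h1 : |(boostStep η p d s x : ℝ) - q x| ≤ |p x + η * s * d.toFun x - q x| := by
    have := Set.abs_projIcc_sub_projIcc (zero_le_one' ℝ) (c := p x + η * s * d.toFun x)
      (d := (q x : ℝ))
    rwa [Set.projIcc_val] at this
  have h2 := sq_le_sq.2 h1
  have hs : (s : ℝ) ^ 2 ≤ 1 := by rcases s with _ | _ | _ <;> simp
  have hd : (d.toFun x) ^ 2 ≤ 1 := (sq_le_one_iff_abs_le_one _).2 (d.abs_toFun_le_one x)
  have h3 : (s : ℝ) ^ 2 * (d.toFun x) ^ 2 ≤ 1 := mul_le_one₀ hs (sq_nonneg _) hd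
  nlinarith [mul_le_mul_of_nonneg_left h3 (sq_nonneg η)]

section Boost

variable {X : Type*} [MeasurableSpace X] [DiscreteMeasurableSpace X]

/-- As long as some distinguisher in `G` has advantage more than `η`, a boosting step decreases the
squared distance from `q` by `η ^ 2`. -/
lemma exists_boostPredictors_potential (μ : Measure X) [IsProbabilityMeasure μ] {η : ℝ}
    (hη : 0 < η) {G : Finset (Distinguisher X)} (hG : G.Nonempty) (q : Predictor X) (t : ℕ) :
    ∃ p ∈ boostPredictors η G t, (∀ d ∈ G, adv μ d p q ≤ η) ∨
      ∫ x, ((p x : ℝ) - q x) ^ 2 ∂μ ≤ 1 - t * η ^ 2 := by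
  have hsq : ∀ (p : Predictor X) x, |((p x : ℝ) - q x) ^ 2| ≤ 1 := fun p x => by
    rw [abs_of_nonneg (sq_nonneg _)]
    exact (sq_le_one_iff_abs_le_one _).2 (abs_predictor_sub_le_one p q x)
  have hisq : ∀ p : Predictor X, Integrable (fun x => ((p x : ℝ) - q x) ^ 2) μ := fun p =>
    integrable_of_abs_le Measurable.of_discrete (hsq p)
  induction t with
  | zero =>
    refine ⟨fun _ => 0, by simp [boostPredictors], Or.inr ?_⟩
    have := integral_mono (hisq fun _ => 0) (integrable_const (1 : ℝ))
      fun x => (le_abs_self _).trans (hsq (fun _ => 0) x)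
    simpa using this
  | succ t ih =>
    obtain ⟨p, hp, h⟩ := ih
    by_cases hgood : ∀ d ∈ G, adv μ d p q ≤ η
    · obtain ⟨d, hd⟩ := hG
      exact ⟨p, by simpa [boostStep_zero] using boostStep_mem hp hd 0, Or.inl hgood⟩
    · have hΦ := h.resolve_left hgood
      push Not at hgood
      obtain ⟨d, hd, hadv⟩ := hgood
      rw [adv_eq] at hadv
      set c : ℝ := ∫ x, ((p x : ℝ) - q x) * d.toFun x ∂μ with hc
      have hint : Integrable (fun x => ((p x : ℝ) - q x) * d.toFun x) μ :=
        integrable_of_abs_le Measurable.of_discrete (abs_predictor_sub_mul_le_one p q d)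
      refine ⟨boostStep η p d (-SignType.sign c), boostStep_mem hp hd _, Or.inr ?_⟩
      have hsign : ((SignType.sign c : SignType) : ℝ) * c = |c| := sign_mul_self c
      have hneg : ((-SignType.sign c : SignType) : ℝ) = -((SignType.sign c : SignType) : ℝ) := by
        simp
      have h12 : Integrable (fun x => ((p x : ℝ) - q x) ^ 2 +
          2 * η * ((-SignType.sign c : SignType) : ℝ) * (((p x : ℝ) - q x) * d.toFun x)) μ :=
        (hisq p).add (hint.const_mul _)
      have hle := integral_mono (hisq (boostStep η p d (-SignType.sign c)))
        (h12.add (integrable_const (η ^ 2)))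
        fun x => sq_boostStep_sub_le η p q d (-SignType.sign c) x
      simp only [Pi.add_apply] at hle
      rw [integral_add h12 (integrable_const _),
        integral_add (hisq p) (hint.const_mul _), integral_const_mul, ← hc, hneg] at hle
      simp only [integral_const, probReal_univ, one_smul] at hle
      push_cast
      have : 2 * η * (-((SignType.sign c : SignType) : ℝ)) * c = -(2 * η * |c|) := by
        rw [← hsign]; ring
      rw [this] at hle
      nlinarith

/-- Enough boosting steps reach a predictor that no distinguisher in `G` tells from `q`. -/
lemma exists_boostPredictors_adv_le (μ : Measure X) [IsProbabilityMeasure μ] {η : ℝ}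
    (hη : 0 < η) {G : Finset (Distinguisher X)} (hG : G.Nonempty) (q : Predictor X) {T : ℕ}
    (hT : 1 < T * η ^ 2) : ∃ p ∈ boostPredictors η G T, ∀ d ∈ G, adv μ d p q ≤ η := by
  obtain ⟨p, hp, h⟩ := exists_boostPredictors_potential μ hη hG q T
  refine ⟨p, hp, h.resolve_right fun h' => ?_⟩
  have : 0 ≤ ∫ x, ((p x : ℝ) - q x) ^ 2 ∂μ := integral_nonneg fun x => sq_nonneg _
  linarith

end Boost

/-! ### The learner -/

/-- The residual of `p` on one example, weighted by the function of `d`. -/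
def residual {X : Type*} (p : Predictor X) (d : Distinguisher X) (z : X × Bool) : ℝ :=
  ((if z.2 then 1 else 0) - p z.1) * d.toFun z.1

lemma abs_residual_le_one {X : Type*} (p : Predictor X) (d : Distinguisher X) (z : X × Bool) :
    |residual p d z| ≤ 1 := by
  rw [residual, abs_mul]
  refine mul_le_one₀ ?_ (abs_nonneg _) (d.abs_toFun_le_one z.1)
  have h1 := (p z.1).2
  rw [abs_le]
  split_ifs <;> constructor <;> linarith [h1.1, h1.2]

open Classical in
/-- Empirical selection: a predictor reached by `T` boosting steps all of whose empirical
correlations with members of `G` are small, or `0` if there is none. The threshold allows for the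
advantage `γ` that boosting guarantees and for a sampling error `γ / 2`. -/
noncomputable def selectPredictor {X : Type*} (γ : ℝ) (T : ℕ) (G : Finset (Distinguisher X)) {m : ℕ}
    (y : Fin m → X × Bool) : Predictor X :=
  if h : ∃ p ∈ boostPredictors γ G T, ∀ d ∈ G, |∑ i, residual p d (y i)| ≤ m * (3 / 2 * γ)
  then h.choose else fun _ => 0

section Learner

variable {X : Type*} [MeasurableSpace X] [DiscreteMeasurableSpace X]

lemma abs_integral_residual (μ : Measure X) [IsProbabilityMeasure μ] (p q : Predictor X)
    (d : Distinguisher X) : |∫ z, residual p d z ∂(exampleLaw μ q)| = adv μ d p q := by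
  rw [integral_exampleLaw μ q (abs_residual_le_one p d), adv_eq, ← abs_neg, ← integral_neg]
  congr 1
  refine integral_congr_ae (Filter.Eventually.of_forall fun x => ?_)
  simp only [residual, if_true]
  norm_num
  ring

/-- Hoeffding's inequality and a union bound over the finitely many reachable predictors and the
members of `G`. -/
lemma pi_selectPredictor_le (μ : Measure X) [IsProbabilityMeasure μ] {γ : ℝ} (hγ : 0 < γ)
    {T : ℕ} (hT : 1 < T * γ ^ 2) {G : Finset (Distinguisher X)} (hG : G.Nonempty) {N : ℕ}
    (hGN : G.card ≤ N) (q : Predictor X) (m : ℕ) :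
    Measure.pi (fun _ : Fin m => exampleLaw μ q)
      {y | ¬ ∀ d ∈ G, adv μ d (selectPredictor γ T G y) q ≤ 2 * γ} ≤
      ENNReal.ofReal (2 * (3 * N) ^ T * N * Real.exp (-(m * γ ^ 2 / 8))) := by
  classical
  set Q := Measure.pi (fun _ : Fin m => exampleLaw μ q) with hQ
  rcases Nat.eq_zero_or_pos m with hm0 | hm
  · -- Without examples the bound exceeds one.
    refine prob_le_one.trans ?_
    rw [← ENNReal.ofReal_one]
    refine ENNReal.ofReal_le_ofReal ?_
    have : (1 : ℝ) ≤ N := by exact_mod_cast hG.card_pos.trans_le hGN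
    have h3 : (1 : ℝ) ≤ (3 * N) ^ T := one_le_pow₀ (by linarith)
    rw [hm0]
    simp only [Nat.cast_zero, zero_mul, zero_div, neg_zero, Real.exp_zero, mul_one]
    nlinarith
  have hm' : (0 : ℝ) < m := by exact_mod_cast hm
  set S : Predictor X → Distinguisher X → Set (Fin m → X × Bool) := fun p d =>
    {y | m * (γ / 2) ≤ ∑ i, (residual p d (y i) - ∫ w, residual p d w ∂(exampleLaw μ q))} ∪
    {y | m * (γ / 2) ≤ ∑ i, (-residual p d (y i) - ∫ w, -residual p d w ∂(exampleLaw μ q))} with hS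
  have hSle : ∀ p d, Q (S p d) ≤ ENNReal.ofReal (2 * Real.exp (-(m * γ ^ 2 / 8))) := by
    intro p d
    have hmeas : Measurable (residual p d) := measurable_of_discrete_prod_bool _
    have h1 := pi_real_hoeffding (ι := Fin m) (exampleLaw μ q) hmeas
      (c := 1) one_pos (abs_residual_le_one p d) (t := γ / 2) (by positivity)
    have h2 := pi_real_hoeffding (ι := Fin m) (exampleLaw μ q) hmeas.neg
      (c := 1) one_pos (fun z => by simpa using abs_residual_le_one p d z) (t := γ / 2)
      (by positivity)
    have e : (m : ℝ) * (γ / 2) ^ 2 / (2 * 1 ^ 2) = m * γ ^ 2 / 8 := by ring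
    rw [Fintype.card_fin, e] at h1 h2
    rw [← ENNReal.ofReal_toReal (measure_ne_top Q (S p d))]
    refine ENNReal.ofReal_le_ofReal ?_
    calc Q.real (S p d) ≤ _ := measureReal_union_le _ _
      _ ≤ Real.exp (-(m * γ ^ 2 / 8)) + Real.exp (-(m * γ ^ 2 / 8)) := add_le_add h1 h2
      _ = _ := by ring
  have hgood : ∀ p d (y : Fin m → X × Bool), y ∉ S p d →
      |∑ i, residual p d (y i) - m * ∫ w, residual p d w ∂(exampleLaw μ q)| ≤ m * (γ / 2) := by
    intro p d y hy
    simp only [hS, Set.mem_union, Set.mem_ofPred_eq, not_or, not_le, Finset.sum_sub_distrib,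
      Finset.sum_neg_distrib, integral_neg, Finset.sum_const, Finset.card_univ, Fintype.card_fin,
      nsmul_eq_mul] at hy
    rw [abs_le]
    constructor <;> linarith [hy.1, hy.2]
  have hsub : {y | ¬ ∀ d ∈ G, adv μ d (selectPredictor γ T G y) q ≤ 2 * γ} ⊆
      ⋃ a ∈ boostPredictors γ G T ×ˢ G, S a.1 a.2 := by
    intro y hy
    by_contra hno
    simp only [Set.mem_iUnion, not_exists] at hno
    have hall : ∀ p ∈ boostPredictors γ G T, ∀ d ∈ G, y ∉ S p d := fun p hp d hd =>
      hno (p, d) (Finset.mem_product.2 ⟨hp, hd⟩)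
    refine hy ?_
    have hex : ∃ p ∈ boostPredictors γ G T, ∀ d ∈ G,
        |∑ i, residual p d (y i)| ≤ m * (3 / 2 * γ) := by
      obtain ⟨p, hp, h⟩ := exists_boostPredictors_adv_le μ hγ hG q hT
      refine ⟨p, hp, fun d hd => ?_⟩
      have h1 := h d hd
      rw [← abs_integral_residual] at h1
      have h2 := abs_le.1 (hgood p d y (hall p hp d hd))
      have h3 := abs_le.1 h1
      rw [abs_le]
      constructor <;> nlinarith [h2.1, h2.2, h3.1, h3.2]
    intro d hd
    have hsel : selectPredictor γ T G y = hex.choose := by rw [selectPredictor, dif_pos hex]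
    rw [hsel, ← abs_integral_residual]
    have h1 := abs_le.1 (hex.choose_spec.2 d hd)
    have h2 := abs_le.1 (hgood _ d y (hall _ hex.choose_spec.1 d hd))
    rw [abs_le]
    constructor
    · refine le_of_mul_le_mul_left ?_ hm'
      linarith [h1.1, h2.2]
    · refine le_of_mul_le_mul_left ?_ hm'
      linarith [h1.2, h2.1]
  calc Q {y | ¬ ∀ d ∈ G, adv μ d (selectPredictor γ T G y) q ≤ 2 * γ}
      ≤ Q (⋃ a ∈ boostPredictors γ G T ×ˢ G, S a.1 a.2) := measure_mono hsub
    _ ≤ ∑ a ∈ boostPredictors γ G T ×ˢ G, Q (S a.1 a.2) := measure_biUnion_finset_le _ _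
    _ ≤ ∑ a ∈ boostPredictors γ G T ×ˢ G, ENNReal.ofReal (2 * Real.exp (-(m * γ ^ 2 / 8))) :=
        Finset.sum_le_sum fun a _ => hSle _ _
    _ = ENNReal.ofReal (((boostPredictors γ G T).card * G.card : ℕ) *
          (2 * Real.exp (-(m * γ ^ 2 / 8)))) := by
        rw [Finset.sum_const, Finset.card_product, nsmul_eq_mul,
          ← ENNReal.ofReal_natCast, ← ENNReal.ofReal_mul (by positivity)]
    _ ≤ _ := by
        refine ENNReal.ofReal_le_ofReal ?_
        have h1 : (((boostPredictors γ G T).card * G.card : ℕ) : ℝ) ≤ (3 * N) ^ T * N := by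
          have : (boostPredictors γ G T).card * G.card ≤ (3 * N) ^ T * N :=
            Nat.mul_le_mul ((card_boostPredictors_le _ _ _).trans
              (Nat.pow_le_pow_left (Nat.mul_le_mul_left 3 hGN) T)) hGN
          exact_mod_cast this
        calc _ ≤ (3 * (N : ℝ)) ^ T * N * (2 * Real.exp (-(m * γ ^ 2 / 8))) := by gcongr
          _ = _ := by ring

/-- Packings on a sample are packings on the sample taken twice. -/
lemma PackingLE.of_double {X ι : Type*} [Fintype ι] {D : Set (Distinguisher X)} {γ : ℝ} {N : ℕ}
    {x : ι → X} (h : PackingLE D γ N (Sum.elim x x)) : PackingLE D γ N x := by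
  intro F hF hsep
  refine h F hF fun f hf g hg hfg => ?_
  have := hsep f hf g hg hfg
  simp only [Separated, Fintype.sum_sum_type, Sum.elim_inl, Sum.elim_inr, Fintype.card_sum,
    Nat.cast_add] at this ⊢
  linarith

/-- A correct predictor for the net is correct for `D`. -/
lemma advClass_le_of_net (μ : Measure X) [IsProbabilityMeasure μ] {D : Set (Distinguisher X)}
    (hD : D.Nonempty) {G : Finset (Distinguisher X)} {a b : ℝ} {p q : Predictor X}
    (hp : ∀ g ∈ G, adv μ g p q ≤ a)
    (hnet : ∀ d ∈ D, ∃ g ∈ G, ∫ x, |d.toFun x - g.toFun x| ∂μ ≤ b) :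
    advClass μ D p q ≤ a + b := by
  refine advClass_le μ hD fun d hd => ?_
  obtain ⟨g, hg, hdg⟩ := hnet d hd
  have h1 := hp g hg
  rw [adv_eq] at h1 ⊢
  have hint : ∀ d : Distinguisher X, Integrable (fun x => ((p x : ℝ) - q x) * d.toFun x) μ :=
    fun d => integrable_of_abs_le Measurable.of_discrete (abs_predictor_sub_mul_le_one p q d)
  have hdist : Integrable (fun x => |d.toFun x - g.toFun x|) μ :=
    ((integrable_of_abs_le Measurable.of_discrete d.abs_toFun_le_one).sub
      (integrable_of_abs_le Measurable.of_discrete g.abs_toFun_le_one)).abs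
  have h2 : |∫ x, ((p x : ℝ) - q x) * d.toFun x ∂μ - ∫ x, ((p x : ℝ) - q x) * g.toFun x ∂μ| ≤
      ∫ x, |d.toFun x - g.toFun x| ∂μ := by
    rw [← integral_sub (hint d) (hint g)]
    refine (abs_integral_le_integral_abs).trans
      (integral_mono ((hint d).sub (hint g)).abs hdist fun x => ?_)
    simp only
    rw [← mul_sub, abs_mul]
    exact mul_le_of_le_one_left (abs_nonneg _) (abs_predictor_sub_le_one p q x)
  have h3 := abs_le.1 h1
  have h4 := abs_le.1 h2
  rw [abs_le]
  constructor <;> linarith [h3.1, h3.2, h4.1, h4.2]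

/-- The learner: build a net of `D` on the first `n` individuals, then select empirically on the
other `m` examples among the predictors that boosting over this net can reach. -/
lemma nonempty_DFR {D : Set (Distinguisher X)} (hD : D.Nonempty) {γ δ : ℝ} (hγ : 0 < γ)
    {n m N T : ℕ} (hN : ∀ z : Fin n ⊕ Fin n → X, PackingLE D γ N z) (hT : 1 < T * γ ^ 2)
    (hn : Real.exp (-(n * γ ^ 2 / 8)) ≤ 1 / 2)
    (hδ : 2 * N ^ 2 * Real.exp (-(n * γ ^ 2 / 8)) +
      2 * (3 * N) ^ T * N * Real.exp (-(m * γ ^ 2 / 8)) ≤ δ) :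
    (DFR (n + m) Set.univ D (25 * γ) δ).Nonempty := by
  classical
  choose G hGD hGN hnet using fun x : Fin n → X => (hN (Sum.elim x x)).of_double.exists_net hγ
  have hGne : ∀ x, (G x).Nonempty := fun x => by
    obtain ⟨d, hd⟩ := hD
    obtain ⟨g, hg, -⟩ := hnet x d hd
    exact ⟨g, hg⟩
  let A : Learner X (n + m) :=
    { Seed := Unit
      seedSpace := inferInstance
      seedLaw := Measure.dirac ()
      seedProb := inferInstance
      run := fun z _ => selectPredictor γ T (G fun i => (z (Fin.castAdd m i)).1)
        fun j => z (Fin.natAdd n j) }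
  refine ⟨A, ?_⟩
  simp only [DFR, DSR, Set.mem_iInter, Set.mem_ofPred_eq, Set.mem_univ, forall_true_left]
  intro μ hμ q
  have := hμ.1
  simp only [OI, Set.mem_ofPred_eq]
  set ν := exampleLaw μ q with hν
  have hνn : PowersNullMeasurable ν := hμ.powersNullMeasurable_exampleLaw q
  set F : Set (Fin (n + m) → X × Bool) := {z | ¬ advClass μ D (selectPredictor γ T
    (G fun i => (z (Fin.castAdd m i)).1) fun j => z (Fin.natAdd n j)) q ≤ 25 * γ} with hF
  have hseed : A.jointLaw μ q {z | ¬ advClass μ D (A.run z.1 z.2) q ≤ 25 * γ} =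
      Measure.pi (fun _ => ν) F := by
    have : {z : (Fin (n + m) → X × Bool) × A.Seed | ¬ advClass μ D (A.run z.1 z.2) q ≤ 25 * γ} =
        F ×ˢ Set.univ := by
      ext z
      simp [hF, A]
    rw [this, Learner.jointLaw, Measure.prod_prod, measure_univ, mul_one]
  rw [hseed, ← (measurePreserving_comp_equiv ν finSumFinEquiv).measure_preimage_equiv F,
    hνn.pi_sum_apply]
  set bad : Set (Fin n → X) := {x | ∃ d ∈ D, ∃ d' ∈ D,
      ∑ i, |d.toFun (x i) - d'.toFun (x i)| ≤ 21 / 5 * γ * Fintype.card (Fin n) ∧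
      23 * γ < ∫ x, |d.toFun x - d'.toFun x| ∂μ} with hbad
  set φ : (Fin n → X × Bool) → (Fin n → X) := fun z i => (z i).1 with hφ
  set b : ENNReal := ENNReal.ofReal (2 * (3 * N) ^ T * N * Real.exp (-(m * γ ^ 2 / 8))) with hb
  have hpt : ∀ x : Fin n → X × Bool, Measure.pi (fun _ : Fin m => ν) {y | Sum.elim x y ∈
      MeasurableEquiv.arrowCongr' finSumFinEquiv (MeasurableEquiv.refl (X × Bool)) ⁻¹' F} ≤
      (φ ⁻¹' bad).indicator 1 x + b := by
    intro x
    by_cases hx : φ x ∈ bad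
    · rw [Set.indicator_of_mem (show x ∈ φ ⁻¹' bad from hx)]
      exact prob_le_one.trans le_self_add
    · rw [Set.indicator_of_notMem (show x ∉ φ ⁻¹' bad from hx), zero_add]
      refine le_trans (measure_mono ?_)
        (pi_selectPredictor_le μ hγ hT (hGne (φ x)) (hGN (φ x)) q m)
      intro y hy hsel
      have hxl : ∀ i, (MeasurableEquiv.arrowCongr' finSumFinEquiv (MeasurableEquiv.refl (X × Bool)))
          (Sum.elim x y) (Fin.castAdd m i) = x i := fun i => by
        change Sum.elim x y (finSumFinEquiv.symm (Fin.castAdd m i)) = x i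
        simp
      have hyr : ∀ j, (MeasurableEquiv.arrowCongr' finSumFinEquiv (MeasurableEquiv.refl (X × Bool)))
          (Sum.elim x y) (Fin.natAdd n j) = y j := fun j => by
        change Sum.elim x y (finSumFinEquiv.symm (Fin.natAdd n j)) = y j
        simp
      simp only [Set.mem_ofPred_eq, Set.mem_preimage, hF, hxl, hyr] at hy
      refine hy ?_
      rw [show 25 * γ = 2 * γ + 23 * γ by ring]
      refine advClass_le_of_net μ hD (G := G (φ x)) hsel fun d hd => ?_
      obtain ⟨g, hg, hdg⟩ := hnet (φ x) d hd
      refine ⟨g, hg, not_lt.1 fun hlt => hx ⟨d, hd, g, hGD _ hg, hdg, hlt⟩⟩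
  calc _ ≤ ∫⁻ x, ((φ ⁻¹' bad).indicator 1 x + b) ∂Measure.pi (fun _ : Fin n => ν) :=
        lintegral_mono hpt
    _ = ∫⁻ x, (φ ⁻¹' bad).indicator 1 x ∂Measure.pi (fun _ : Fin n => ν) + b := by
        rw [lintegral_add_right _ measurable_const]
        simp
    _ ≤ Measure.pi (fun _ : Fin n => ν) (φ ⁻¹' bad) + b := by
        gcongr
        exact lintegral_indicator_one_le _
    _ = Measure.pi (fun _ : Fin n => μ) bad + b := by
        rw [(measurePreserving_fst_pi μ q n).measure_preimage (hμ.2 n bad)]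
    _ ≤ ENNReal.ofReal (2 * N ^ 2 * Real.exp (-(n * γ ^ 2 / 8))) + b := by
        gcongr
        have := hμ.pi_close_far_le hγ hN (by simpa using hn)
        simp only [hbad, Fintype.card_fin] at this ⊢
        exact this
    _ ≤ ENNReal.ofReal δ := by
        rw [hb, ← ENNReal.ofReal_add (by positivity) (by positivity)]
        exact ENNReal.ofReal_le_ofReal hδ

end Learner

/-! ### The upper bound on the sample size -/

lemma patternCount_zero_le (n B : ℕ) : patternCount n B 0 ≤ 1 := by
  have := card_patterns_mul_pow_le (ι := Fin n) (κ := Fin B) 0 le_rfl zero_le_one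
  simp only [pow_zero, mul_one, mul_zero, add_zero, one_pow] at this
  exact_mod_cast this

/-- A Sauer-type bound, from the weight `d / (n * B)` of each selected coordinate. -/
lemma log_patternCount_le {n B d : ℕ} (hd : 0 < d) (hdn : d ≤ n * B) :
    Real.log (patternCount n B d) ≤ d * (1 + Real.log (n * B / d)) := by
  have hd' : (0 : ℝ) < d := by exact_mod_cast hd
  have hnB : (0 : ℝ) < n * B := by exact_mod_cast hd.trans_le hdn
  set l : ℝ := d / (n * B) with hl
  have hl0 : 0 < l := by positivity
  have hl1 : l ≤ 1 := by rw [hl, div_le_one hnB]; exact_mod_cast hdn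
  have h := card_patterns_mul_pow_le (ι := Fin n) (κ := Fin B) d hl0.le hl1
  rw [Fintype.card_fin, Fintype.card_fin] at h
  have h1 : (patternCount n B d : ℝ) * l ^ d ≤ Real.exp d := by
    refine le_trans h ?_
    calc (1 + (B : ℝ) * l) ^ n ≤ Real.exp (B * l) ^ n := by
          gcongr
          rw [add_comm]
          exact Real.add_one_le_exp _
      _ = Real.exp d := by
          rw [← Real.exp_nat_mul]
          congr 1
          rw [hl, ← mul_assoc, mul_div_cancel₀ _ hnB.ne']
  rcases Nat.eq_zero_or_pos (patternCount n B d) with h0 | hpos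
  · have : 0 ≤ Real.log (n * B / d) := Real.log_nonneg (by
      rw [le_div_iff₀ hd', one_mul]; exact_mod_cast hdn)
    rw [h0]
    simp only [Nat.cast_zero, Real.log_zero]
    positivity
  · have hpos' : (0 : ℝ) < patternCount n B d := by exact_mod_cast hpos
    have h2 := Real.log_le_log (by positivity) h1
    rw [Real.log_exp, Real.log_mul hpos'.ne' (by positivity), Real.log_pow] at h2
    have h3 : Real.log (n * B / d) = -Real.log l := by
      rw [hl, ← Real.log_inv, inv_div]
    rw [h3]
    linarith

lemma sq_log_one_add_le {v : ℝ} (hv : 0 ≤ v) : Real.log (1 + v) ^ 2 ≤ 4 * v := by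
  have h0 : 0 ≤ Real.log (1 + v) := Real.log_nonneg (by linarith)
  have h1 : Real.log (1 + v) ≤ 2 * Real.sqrt v := by
    have h2 : 1 + v ≤ (1 + Real.sqrt v) ^ 2 := by
      nlinarith [Real.sq_sqrt hv, Real.sqrt_nonneg v]
    calc Real.log (1 + v) ≤ Real.log ((1 + Real.sqrt v) ^ 2) := Real.log_le_log (by linarith) h2
      _ = 2 * Real.log (1 + Real.sqrt v) := by rw [Real.log_pow]; norm_num
      _ ≤ 2 * Real.sqrt v := by
          have := Real.log_le_sub_one_of_pos (show 0 < 1 + Real.sqrt v by positivity)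
          linarith
  calc Real.log (1 + v) ^ 2 ≤ (2 * Real.sqrt v) ^ 2 := by gcongr
    _ = 4 * v := by rw [mul_pow, Real.sq_sqrt hv]; norm_num

lemma logb_two_div_eq {ε : ℝ} : Real.log (2 / ε) = Real.logb 2 (2 / ε) * Real.log 2 := by
  rw [Real.logb, div_mul_cancel₀]
  exact (Real.log_pos (by norm_num)).ne'

lemma one_le_logb_two_div {ε : ℝ} (h0 : 0 < ε) (h1 : ε < 1) : 1 ≤ Real.logb 2 (2 / ε) := by
  rw [Real.le_logb_iff_rpow_le (by norm_num) (by positivity), Real.rpow_one, le_div_iff₀ h0]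
  linarith

lemma logb_two_div_le {ε : ℝ} (h0 : 0 < ε) (h1 : ε < 1) : Real.logb 2 (2 / ε) ≤ 2 / ε := by
  have hx : (2 : ℝ) ≤ 2 / ε := by rw [le_div_iff₀ h0]; linarith
  rw [Real.logb, div_le_iff₀ (Real.log_pos (by norm_num))]
  -- Apply `log y ≤ y - 1` to half of `2 / ε`.
  have hl2 : (0.69 : ℝ) < Real.log 2 := by linarith [Real.log_two_gt_d9]
  have h := Real.log_le_sub_one_of_pos (show 0 < 2 / ε / 2 by positivity)
  rw [Real.log_div (by positivity) (by norm_num)] at h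
  have hl2' : Real.log 2 < 0.7 := by linarith [Real.log_two_lt_d9]
  nlinarith

lemma one_le_ceil_one_div {γ : ℝ} (h0 : 0 < γ) (h1 : γ < 1 / 25) : (1 : ℝ) ≤ ⌈1 / γ⌉₊ :=
  le_trans (by rw [le_div_iff₀ h0]; linarith) (Nat.le_ceil _)

lemma ceil_one_div_le {γ : ℝ} (h0 : 0 < γ) (h1 : γ < 1 / 25) : (⌈1 / γ⌉₊ : ℝ) ≤ 2 / γ := by
  have h1γ : 1 ≤ 1 / γ := by rw [le_div_iff₀ h0]; linarith
  have := Nat.ceil_lt_add_one (show 0 ≤ 1 / γ by positivity)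
  calc (⌈1 / γ⌉₊ : ℝ) ≤ 1 / γ + 1 := this.le
    _ ≤ 1 / γ + 1 / γ := by linarith
    _ = 2 / γ := by ring

/-- The constant of the packing bound is polynomial in `2 / ε`. -/
lemma ceil_packing_le {ε : ℝ} (h0 : 0 < ε) (h1 : ε < 1) :
    (⌈40 * (⌈1 / (ε / 25)⌉₊ : ℝ) / (ε / 25)⌉₊ : ℝ) ≤ (2 / ε) ^ 16 := by
  have hγ0 : 0 < ε / 25 := by positivity
  have hB2 := ceil_one_div_le hγ0 (by linarith)
  have h3 := (Nat.ceil_lt_add_one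
    (show 0 ≤ 40 * (⌈1 / (ε / 25)⌉₊ : ℝ) / (ε / 25) by positivity)).le
  have h4 : 40 * (⌈1 / (ε / 25)⌉₊ : ℝ) / (ε / 25) ≤ 50000 / ε ^ 2 := by
    calc 40 * (⌈1 / (ε / 25)⌉₊ : ℝ) / (ε / 25) ≤ 40 * (2 / (ε / 25)) / (ε / 25) := by gcongr
      _ = 50000 / ε ^ 2 := by field_simp; norm_num
  have h5 : 1 ≤ 1 / ε ^ 2 := by
    rw [le_div_iff₀ (by positivity), one_mul]
    exact pow_le_one₀ h0.le h1.le
  have h6 : 50000 / ε ^ 2 + 1 / ε ^ 2 ≤ (2 / ε) ^ 16 := by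
    rw [← add_div, div_pow]
    have h7 : ε ^ 16 ≤ ε ^ 2 := pow_le_pow_of_le_one h0.le h1.le (by norm_num)
    gcongr
    norm_num
  linarith

/-- The base of the Sauer-type bound is polynomial in `2 / ε`, up to a factor `1 + u / d`. -/
lemma sauer_base_le {ε u d n : ℝ} (h0 : 0 < ε) (h1 : ε < 1) (hu : 1 ≤ u) (hd : 1 ≤ d)
    (hn : n ≤ 32768 * (d * Real.logb 2 (2 / ε) ^ 2 + u) / (ε / 25) ^ 2) :
    (n + n) * (⌈1 / (ε / 25)⌉₊ : ℝ) / d ≤ (2 / ε) ^ 33 * (1 + u / d) := by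
  set L := Real.logb 2 (2 / ε) with hL
  set v := u / d with hv
  have hd' : 0 < d := by linarith
  have hv0 : 0 ≤ v := by positivity
  have hdv : d * v = u := by rw [hv]; field_simp
  have hL1 : 1 ≤ L := one_le_logb_two_div h0 h1
  have hγ0 : 0 < ε / 25 := by positivity
  have hB2 := ceil_one_div_le hγ0 (by linarith)
  have hx1 : 1 ≤ (2 / ε) ^ 2 := one_le_pow₀ (by rw [le_div_iff₀ h0]; linarith)
  have e2 : L ^ 2 + v ≤ (2 / ε) ^ 2 * (1 + v) := by
    have e3 : L ^ 2 ≤ (2 / ε) ^ 2 := by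
      have := logb_two_div_le h0 h1
      gcongr
    have e4 : v ≤ (2 / ε) ^ 2 * v := le_mul_of_one_le_left hv0 hx1
    rw [mul_add, mul_one]
    exact add_le_add e3 e4
  rw [show d * L ^ 2 + u = d * (L ^ 2 + v) by rw [mul_add, hdv]] at hn
  set γ := ε / 25 with hγ
  calc (n + n) * (⌈1 / γ⌉₊ : ℝ) / d
      ≤ (32768 * (d * (L ^ 2 + v)) / γ ^ 2 + 32768 * (d * (L ^ 2 + v)) / γ ^ 2) * (2 / γ) / d := by
        gcongr
    _ = 131072 / γ ^ 3 * (L ^ 2 + v) := by field_simp; norm_num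
    _ ≤ 131072 / γ ^ 3 * ((2 / ε) ^ 2 * (1 + v)) := by gcongr
    _ = (2048000000 / ε ^ 3 * (2 / ε) ^ 2) * (1 + v) := by rw [hγ]; field_simp; norm_num
    _ ≤ ((2 / ε) ^ 31 * (2 / ε) ^ 2) * (1 + v) := by
        have h7 : ε ^ 31 ≤ ε ^ 3 := pow_le_pow_of_le_one h0.le h1.le (by norm_num)
        have h8 : 2048000000 / ε ^ 3 ≤ (2 / ε) ^ 31 := by
          rw [div_pow 2 ε 31]
          gcongr
          norm_num
        gcongr
    _ = _ := by ring

/-- The size of a packing on `2 n` points, where `n` is the sample size used for the net: up to a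
constant factor its logarithm is `d * L ^ 2 + u`, with no term in `log d` or `L * u`. -/
lemma log_packing_le {ε u : ℝ} (h0 : 0 < ε) (h1 : ε < 1) (hu : 1 ≤ u) {d n : ℕ}
    (hn : n = ⌈16384 * (d * Real.logb 2 (2 / ε) ^ 2 + u) / (ε / 25) ^ 2⌉₊) :
    Real.log (2 * (⌈40 * (⌈1 / (ε / 25)⌉₊ : ℝ) / (ε / 25)⌉₊ : ℝ) ^
        Nat.log 2 (patternCount (n + n) ⌈1 / (ε / 25)⌉₊ d)) ≤
      569 * (d * Real.logb 2 (2 / ε) ^ 2 + u) := by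
  have hγ0 : 0 < ε / 25 := by positivity
  have hγ1 : ε / 25 < 1 / 25 := by linarith
  have hKx := ceil_packing_le h0 h1
  have hB1 := one_le_ceil_one_div hγ0 hγ1
  have hL1 := one_le_logb_two_div h0 h1
  have hlogx := logb_two_div_eq (ε := ε)
  have hbase' := fun (d n : ℝ) => sauer_base_le (d := d) (n := n) h0 h1 hu
  have hx0 : 0 < 2 / ε := by positivity
  have hK1 : (1 : ℝ) ≤ ⌈40 * (⌈1 / (ε / 25)⌉₊ : ℝ) / (ε / 25)⌉₊ := by
    refine le_trans ?_ (Nat.le_ceil _)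
    rw [le_div_iff₀ hγ0]; linarith
  set L := Real.logb 2 (2 / ε)
  set W := d * L ^ 2 + u with hW
  set B := ⌈1 / (ε / 25)⌉₊
  set K := ⌈40 * (B : ℝ) / (ε / 25)⌉₊
  set k := Nat.log 2 (patternCount (n + n) B d) with hk
  have hdL : (0 : ℝ) ≤ d * L ^ 2 := by positivity
  have hW1 : 1 ≤ W := by linarith
  have hl2' : Real.log 2 < 1 := by linarith [Real.log_two_lt_d9]
  have hl2 : 0 < Real.log 2 := Real.log_pos (by norm_num)
  have hlogK : Real.log K ≤ 16 * (L * Real.log 2) := by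
    calc Real.log K ≤ Real.log ((2 / ε) ^ 16) := Real.log_le_log (by linarith) hKx
      _ = _ := by rw [Real.log_pow, hlogx]; norm_num
  rw [Real.log_mul (by norm_num) (by positivity), Real.log_pow]
  rcases Nat.eq_zero_or_pos d with hd | hd
  · have hk0 : k = 0 := by
      rw [hk, hd]
      exact Nat.log_of_lt (lt_of_le_of_lt (patternCount_zero_le _ _) (by norm_num))
    rw [hk0]
    simp only [Nat.cast_zero, zero_mul, add_zero]
    linarith
  · have hd' : (0 : ℝ) < d := by exact_mod_cast hd
    have hd1 : (1 : ℝ) ≤ d := by exact_mod_cast hd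
    have hγsq : (ε / 25) ^ 2 ≤ 1 := pow_le_one₀ hγ0.le (by linarith)
    have hγsq0 : 0 < (ε / 25) ^ 2 := by positivity
    have hge : 16384 * W ≤ 16384 * W / (ε / 25) ^ 2 := by
      rw [le_div_iff₀ hγsq0]
      exact mul_le_of_le_one_right (by linarith) hγsq
    have hnge : 16384 * W / (ε / 25) ^ 2 ≤ n := by rw [hn]; exact Nat.le_ceil _
    have hnle : (n : ℝ) ≤ 32768 * W / (ε / 25) ^ 2 := by
      have := Nat.ceil_lt_add_one (show 0 ≤ 16384 * W / (ε / 25) ^ 2 by positivity)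
      rw [← hn] at this
      calc (n : ℝ) ≤ 16384 * W / (ε / 25) ^ 2 + 16384 * W / (ε / 25) ^ 2 := by linarith
        _ = _ := by ring
    have hdn : (d : ℝ) ≤ n := by
      have e1 : (d : ℝ) ≤ d * L ^ 2 := le_mul_of_one_le_right hd'.le (one_le_pow₀ hL1)
      linarith
    have hn0 : (0 : ℝ) < n := by linarith
    have hdnB : d ≤ (n + n) * B := by
      have : (d : ℝ) ≤ (n + n) * B :=
        (show (d : ℝ) ≤ n + n by linarith).trans (le_mul_of_one_le_right (by linarith) hB1)
      exact_mod_cast this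
    have hbase := hbase' d n hd1 hnle
    set v := u / d with hv
    have hv0 : 0 ≤ v := by positivity
    have hdv : d * v = u := by rw [hv]; field_simp
    have hlog1v : 0 ≤ Real.log (1 + v) := Real.log_nonneg (by linarith)
    have hlogbase : Real.log (((n + n : ℕ) : ℝ) * B / d) ≤
        33 * (L * Real.log 2) + Real.log (1 + v) := by
      push_cast
      refine (Real.log_le_log (by positivity) hbase).trans (le_of_eq ?_)
      rw [Real.log_mul (by positivity) (by positivity), Real.log_pow, hlogx]
      norm_num
    have hlogy := log_patternCount_le hd hdnB
    have hkle : k * Real.log 2 ≤ d * (1 + (33 * (L * Real.log 2) + Real.log (1 + v))) := by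
      rcases Nat.eq_zero_or_pos (patternCount (n + n) B d) with hz | hz
      · have : k = 0 := by rw [hk, hz]; simp
        rw [this]
        simp only [Nat.cast_zero, zero_mul]
        positivity
      · have hpow : (2 : ℝ) ^ k ≤ patternCount (n + n) B d := by
          exact_mod_cast Nat.pow_log_le_self 2 hz.ne'
        have := Real.log_le_log (by positivity) hpow
        rw [Real.log_pow] at this
        refine this.trans (hlogy.trans ?_)
        gcongr
    -- The cross term `L * log (1 + u / d)` is absorbed by `L ^ 2` and `u / d`.
    have hAMGM : L * Real.log (1 + v) ≤ L ^ 2 / 2 + 2 * v := by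
      have := sq_log_one_add_le hv0
      have := two_mul_le_add_sq L (Real.log (1 + v))
      linarith
    have hLL : L ≤ L ^ 2 := le_self_pow₀ hL1 (by norm_num)
    have hLl : Real.log 2 * L ^ 2 ≤ L ^ 2 := mul_le_of_le_one_left (by positivity) hl2'.le
    calc Real.log 2 + k * Real.log K ≤ 1 + k * (16 * (L * Real.log 2)) := by gcongr
      _ = 1 + 16 * L * (k * Real.log 2) := by ring
      _ ≤ 1 + 16 * L * (d * (1 + (33 * (L * Real.log 2) + Real.log (1 + v)))) := by gcongr
      _ = 1 + 16 * d * (L + 33 * (Real.log 2 * L ^ 2) + L * Real.log (1 + v)) := by ring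
      _ ≤ 1 + 16 * d * (L ^ 2 + 33 * L ^ 2 + (L ^ 2 / 2 + 2 * v)) := by gcongr
      _ = 1 + 552 * (d * L ^ 2) + 32 * (d * v) := by ring
      _ ≤ 569 * W := by
          rw [hdv, hW]
          linarith

lemma exp_neg_le_half {δ W : ℝ} (hδ0 : 0 < δ) (hW : Real.logb 2 (2 / δ) ≤ W) (hW0 : 0 ≤ W) :
    Real.exp (-W) ≤ δ / 2 := by
  have hl2' : Real.log 2 < 1 := by linarith [Real.log_two_lt_d9]
  have hl2 : 0 < Real.log 2 := Real.log_pos (by norm_num)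
  have e1 : Real.log (2 / δ) ≤ W := by
    rw [logb_two_div_eq]
    calc Real.logb 2 (2 / δ) * Real.log 2 ≤ W * Real.log 2 := by gcongr
      _ ≤ W := mul_le_of_le_one_right hW0 hl2'.le
  have e2 : 2 / δ ≤ Real.exp W := by rwa [← Real.log_le_iff_le_exp (by positivity)]
  rw [Real.exp_neg, inv_le_comm₀ (Real.exp_pos _) (by positivity), inv_div]
  exact e2

/-- The sample used for the net fails rarely. -/
lemma net_failure_le {N W a b : ℝ} (hN0 : 0 ≤ N) (hN : N ≤ Real.exp b)
    (ha : 1 + 2 * b + W ≤ a) : 2 * N ^ 2 * Real.exp (-a) ≤ Real.exp (-W) := by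
  have htwo : (2 : ℝ) ≤ Real.exp 1 := by linarith [Real.add_one_le_exp (1 : ℝ)]
  calc 2 * N ^ 2 * Real.exp (-a) ≤ Real.exp 1 * Real.exp b ^ 2 * Real.exp (-a) := by gcongr
    _ = Real.exp (1 + 2 * b + -a) := by
        rw [← Real.exp_nat_mul, ← Real.exp_add, ← Real.exp_add]; norm_num
    _ ≤ Real.exp (-W) := Real.exp_le_exp.2 (by linarith)

/-- The sample used for the empirical selection fails rarely. -/
lemma selection_failure_le {N W a b : ℝ} {T : ℕ} (hN0 : 0 ≤ N) (hN : N ≤ Real.exp b)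
    (ha : 1 + T * (2 + b) + b + W ≤ a) :
    2 * (3 * N) ^ T * N * Real.exp (-a) ≤ Real.exp (-W) := by
  have htwo : (2 : ℝ) ≤ Real.exp 1 := by linarith [Real.add_one_le_exp (1 : ℝ)]
  have hthree : (3 : ℝ) ≤ Real.exp 2 := by linarith [Real.add_one_le_exp (2 : ℝ)]
  calc 2 * (3 * N) ^ T * N * Real.exp (-a)
      ≤ Real.exp 1 * (Real.exp 2 * Real.exp b) ^ T * Real.exp b * Real.exp (-a) := by gcongr
    _ = Real.exp (1 + T * (2 + b) + b + -a) := by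
        rw [← Real.exp_add 2, ← Real.exp_nat_mul, ← Real.exp_add, ← Real.exp_add,
          ← Real.exp_add]
    _ ≤ Real.exp (-W) := Real.exp_le_exp.2 (by linarith)

/-- The total of the two sample sizes. -/
lemma sample_sizes_le {g W n m T : ℝ} (hg : 1 ≤ g) (hW : 1 ≤ W) (hT : T ≤ 2 * g)
    (hn : n ≤ 16384 * W * g + 1)
    (hm : m ≤ 8 * g * (W + T * (571 * W) + 570 * W) + 1) : n + m ≤ 51200 * g ^ 2 * W := by
  have hgg : g ≤ g ^ 2 := le_self_pow₀ hg (by norm_num)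
  have h1 : W * g ≤ W * g ^ 2 := by gcongr
  have h2 : W ≤ W * g := le_mul_of_one_le_right (by linarith) hg
  have h3 : 8 * g * (W + T * (571 * W) + 570 * W) ≤
      8 * g * (W + (2 * g) * (571 * W) + 570 * W) := by gcongr
  have h4 : 8 * g * (W + (2 * g) * (571 * W) + 570 * W) = 4568 * (W * g) + 9136 * (W * g ^ 2) := by
    ring
  have h5 : 51200 * g ^ 2 * W = 51200 * (W * g ^ 2) := by ring
  have h6 : 16384 * W * g = 16384 * (W * g) := by ring
  linarith

/-- If the fat-shattering dimension is finite, then some learner succeeds with a sample of the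
claimed size. -/
lemma exists_sample_size {X : Type*} [MeasurableSpace X] [DiscreteMeasurableSpace X]
    {D : Set (Distinguisher X)} (hD : D.Nonempty) {ε δ : ℝ} (h0 : 0 < ε) (h1 : ε < 1)
    (hδ0 : 0 < δ) (hδ1 : δ < 1) {d : ℕ} (hd : fat (functionClass D) (ε / 25) ≤ d) :
    ∃ n : ℕ, (DFR n Set.univ D ε δ).Nonempty ∧
      (n : ℝ) ≤ 20000000000 * (ε ^ 4)⁻¹ *
        (d * Real.logb 2 (2 / ε) ^ 2 + Real.logb 2 (2 / δ)) := by
  have hu1 := one_le_logb_two_div hδ0 hδ1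
  have hW1' : Real.logb 2 (2 / δ) ≤ d * Real.logb 2 (2 / ε) ^ 2 + Real.logb 2 (2 / δ) :=
    le_add_of_nonneg_left (by positivity)
  have hlog := fun n => log_packing_le h0 h1 hu1 (d := d) (n := n)
  set W := d * Real.logb 2 (2 / ε) ^ 2 + Real.logb 2 (2 / δ)
  obtain ⟨γ, hγ⟩ : ∃ γ, γ = ε / 25 := ⟨_, rfl⟩
  rw [← hγ] at hlog hd
  have hγ0 : 0 < γ := by rw [hγ]; positivity
  have hγ1 : γ < 1 / 25 := by rw [hγ]; linarith
  have hγsq : 0 < γ ^ 2 := by positivity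
  have hW1 : 1 ≤ W := by linarith
  obtain ⟨n, hn⟩ : ∃ n, n = ⌈16384 * W / γ ^ 2⌉₊ := ⟨_, rfl⟩
  have hlogN := hlog n hn
  obtain ⟨K, hK⟩ : ∃ K, K = ⌈40 * (⌈1 / γ⌉₊ : ℝ) / γ⌉₊ := ⟨_, rfl⟩
  rw [← hK] at hlogN
  have hKge : 40 * (⌈1 / γ⌉₊ : ℝ) / γ ≤ K := by rw [hK]; exact Nat.le_ceil _
  have hK0 : 0 < K := by
    have hB : 0 < (⌈1 / γ⌉₊ : ℝ) := by linarith [one_le_ceil_one_div hγ0 hγ1]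
    rw [hK]
    exact Nat.ceil_pos.2 (by positivity)
  obtain ⟨N, hN⟩ : ∃ N, N = 2 * K ^ Nat.log 2 (patternCount (n + n) ⌈1 / γ⌉₊ d) := ⟨_, rfl⟩
  have hN0 : (0 : ℝ) < N := by rw [hN]; positivity
  have hNexp : (N : ℝ) ≤ Real.exp (569 * W) := by
    rw [← Real.log_le_iff_le_exp hN0, hN]
    push_cast
    exact hlogN
  obtain ⟨T, hT⟩ : ∃ T, T = ⌊1 / γ ^ 2⌋₊ + 1 := ⟨_, rfl⟩
  have hTγ : 1 < T * γ ^ 2 := by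
    have := Nat.lt_floor_add_one (1 / γ ^ 2)
    rw [div_lt_iff₀ hγsq] at this
    rw [hT]; push_cast; exact this
  have h1γ : 1 ≤ 1 / γ ^ 2 := by
    rw [le_div_iff₀ hγsq, one_mul]
    exact pow_le_one₀ hγ0.le (by linarith)
  have hT2 : (T : ℝ) ≤ 2 * (1 / γ ^ 2) := by
    have := Nat.floor_le (show 0 ≤ 1 / γ ^ 2 by positivity)
    rw [hT]; push_cast
    linarith
  obtain ⟨m, hm⟩ : ∃ m, m = ⌈8 * (1 / γ ^ 2) * (W + T * (571 * W) + 570 * W)⌉₊ := ⟨_, rfl⟩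
  have hnγ : 16384 * W ≤ n * γ ^ 2 := by
    have := Nat.le_ceil (16384 * W / γ ^ 2)
    rwa [div_le_iff₀ hγsq, ← hn] at this
  have hmγ : W + T * (571 * W) + 570 * W ≤ m * γ ^ 2 / 8 := by
    have := Nat.le_ceil (8 * (1 / γ ^ 2) * (W + T * (571 * W) + 570 * W))
    rw [← hm, mul_one_div, div_mul_eq_mul_div, div_le_iff₀ hγsq] at this
    rw [le_div_iff₀ (by norm_num)]
    linarith
  have hfail := exp_neg_le_half hδ0 hW1' (by linarith)
  refine ⟨n + m, ?_, ?_⟩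
  · rw [show ε = 25 * γ by rw [hγ]; ring]
    refine nonempty_DFR hD hγ0 (N := N) (T := T) (fun z F hF hsep => ?_) hTγ ?_ ?_
    · rw [hN]
      exact (card_lt_of_separated hγ0 hd hK0 hKge (by simp) z hF hsep).le
    · have htwo : (2 : ℝ) ≤ Real.exp 1 := by linarith [Real.add_one_le_exp (1 : ℝ)]
      calc Real.exp (-(n * γ ^ 2 / 8)) ≤ Real.exp (-1) := Real.exp_le_exp.2 (by linarith)
        _ ≤ 1 / 2 := by
          rw [Real.exp_neg, one_div]
          exact inv_anti₀ (by norm_num) htwo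
    · have p1 := net_failure_le (W := W) (a := n * γ ^ 2 / 8) hN0.le hNexp (by linarith)
      have p2 := selection_failure_le (W := W) (T := T) (a := m * γ ^ 2 / 8) hN0.le hNexp (by
        have : (T : ℝ) * (2 + 569 * W) ≤ T * (571 * W) := by gcongr; linarith
        linarith)
      linarith
  · have q1 : (n : ℝ) ≤ 16384 * W * (1 / γ ^ 2) + 1 := by
      rw [hn, mul_one_div]
      exact (Nat.ceil_lt_add_one (by positivity)).le
    have q2 : (m : ℝ) ≤ 8 * (1 / γ ^ 2) * (W + T * (571 * W) + 570 * W) + 1 := by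
      rw [hm]
      exact (Nat.ceil_lt_add_one (by positivity)).le
    have := sample_sizes_le h1γ hW1 hT2 q1 q2
    push_cast
    refine this.trans (le_of_eq ?_)
    rw [hγ]
    field_simp
    norm_num

/-! ### The lower bound -/

lemma FatShattered.injective {X : Type*} {F : Set (X → ℝ)} {γ : ℝ} (hγ : 0 < γ) {m : ℕ}
    {x : Fin m → X} (h : FatShattered F γ x) : Function.Injective x := by
  obtain ⟨r, hr⟩ := h
  intro i j hij
  by_contra hne
  have hsign : ∀ k : Fin m, ∀ l, (if l = k then (1 : ℝ) else -1) = -1 ∨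
      (if l = k then (1 : ℝ) else -1) = 1 := fun k l => by split_ifs <;> simp
  obtain ⟨f, -, hf⟩ := hr (fun l => if l = i then 1 else -1) (hsign i)
  obtain ⟨g, -, hg⟩ := hr (fun l => if l = j then 1 else -1) (hsign j)
  have h1 := hf i
  have h2 := hf j
  have h3 := hg i
  have h4 := hg j
  simp only [if_true, if_neg hne, if_neg (Ne.symm hne), hij] at h1 h2 h3 h4
  linarith

/-- The Hamming ball of radius `m / 6` in the cube is small, by its generating function at `1 / 2`. -/
lemma card_hamming_ball_le {m : ℕ} (b₀ : Fin m → Bool) :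
    ((Finset.univ.filter fun b : Fin m → Bool => 6 * hammingDist b b₀ ≤ m).card : ℝ) ≤
      (2 : ℝ) ^ (7 / 8 * m : ℝ) := by
  have hsum : ∑ b : Fin m → Bool, (1 / 2 : ℝ) ^ hammingDist b b₀ = (3 / 2) ^ m := by
    have h := Finset.prod_univ_sum (fun _ : Fin m => (Finset.univ : Finset Bool))
      (fun i o => if o ≠ b₀ i then (1 / 2 : ℝ) else 1)
    rw [Fintype.piFinset_univ] at h
    calc ∑ b : Fin m → Bool, (1 / 2 : ℝ) ^ hammingDist b b₀
        = ∑ b : Fin m → Bool, ∏ i, (if b i ≠ b₀ i then (1 / 2 : ℝ) else 1) := by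
          refine Finset.sum_congr rfl fun b _ => ?_
          rw [Finset.prod_ite, Finset.prod_const, Finset.prod_const_one, mul_one]
          rfl
      _ = ∏ i : Fin m, (3 / 2 : ℝ) := by
          rw [← h]
          refine Finset.prod_congr rfl fun i _ => ?_
          cases b₀ i <;> simp <;> norm_num
      _ = (3 / 2) ^ m := by rw [Finset.prod_const, Finset.card_univ, Fintype.card_fin]
  set V := Finset.univ.filter fun b : Fin m → Bool => 6 * hammingDist b b₀ ≤ m
  have h1 : (V.card : ℝ) * (2 : ℝ) ^ (-(m / 6 : ℝ)) ≤ (3 / 2) ^ m := by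
    rw [← hsum, ← nsmul_eq_mul, ← Finset.sum_const]
    refine (Finset.sum_le_sum fun b hb => ?_).trans (Finset.sum_le_sum_of_subset_of_nonneg
      (Finset.filter_subset _ _) fun b _ _ => by positivity)
    rw [one_div, inv_pow, ← Real.rpow_natCast, ← Real.rpow_neg (by norm_num)]
    refine Real.rpow_le_rpow_of_exponent_le (by norm_num) (neg_le_neg ?_)
    have : ((6 * hammingDist b b₀ : ℕ) : ℝ) ≤ m := by exact_mod_cast (Finset.mem_filter.1 hb).2
    push_cast at this
    linarith
  have h2 : (3 / 2 : ℝ) ≤ 2 ^ (17 / 24 : ℝ) := by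
    refine le_of_pow_le_pow_left₀ (n := 24) (by norm_num) (by positivity) ?_
    rw [← Real.rpow_mul_natCast (by norm_num)]
    norm_num
  have h3 : (3 / 2 : ℝ) ^ m ≤ 2 ^ (17 / 24 * m : ℝ) := by
    rw [Real.rpow_mul_natCast (by norm_num)]
    gcongr
  have h4 : (V.card : ℝ) = V.card * (2 : ℝ) ^ (-(m / 6 : ℝ)) * (2 : ℝ) ^ (m / 6 : ℝ) := by
    rw [mul_assoc, ← Real.rpow_add (by norm_num)]
    simp
  rw [h4]
  calc V.card * (2 : ℝ) ^ (-(m / 6 : ℝ)) * (2 : ℝ) ^ (m / 6 : ℝ)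
      ≤ 2 ^ (17 / 24 * m : ℝ) * (2 : ℝ) ^ (m / 6 : ℝ) := by gcongr; exact h1.trans h3
    _ = (2 : ℝ) ^ (7 / 8 * m : ℝ) := by
        rw [← Real.rpow_add (by norm_num)]
        congr 1
        ring

/-- The deterministic predictor that takes the value `b i` at `x i`, and `0` away from these points. -/
noncomputable def bitPredictor {X : Type*} {m : ℕ} (x : Fin m → X) (b : Fin m → Bool) :
    Predictor X :=
  Function.extend x (fun i => if b i then 1 else 0) 0

lemma bitPredictor_apply {X : Type*} {m : ℕ} {x : Fin m → X} (hx : Function.Injective x)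
    (b : Fin m → Bool) (i : Fin m) : bitPredictor x b (x i) = if b i then 1 else 0 :=
  hx.extend_apply _ _ _

section LowerBound

variable {X : Type*} [MeasurableSpace X] [DiscreteMeasurableSpace X]

/-- The uniform distribution on the indices `Fin m`. -/
noncomputable def uniformIndex (m : ℕ) [NeZero m] : Measure (Fin m) :=
  (PMF.uniformOfFintype (Fin m)).toMeasure

instance (m : ℕ) [NeZero m] : IsProbabilityMeasure (uniformIndex m) := by
  unfold uniformIndex; infer_instance

/-- The uniform distribution on the points `x 0, …, x (m - 1)`. -/
noncomputable def uniformOnPoints {m : ℕ} [NeZero m] (x : Fin m → X) : Measure X :=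
  (uniformIndex m).map x

instance {m : ℕ} [NeZero m] (x : Fin m → X) : IsProbabilityMeasure (uniformOnPoints x) :=
  Measure.isProbabilityMeasure_map Measurable.of_discrete.aemeasurable

lemma integral_uniformOnPoints {m : ℕ} [NeZero m] (x : Fin m → X) (f : X → ℝ) :
    ∫ y, f y ∂(uniformOnPoints x) = (∑ i, f (x i)) / m := by
  rw [uniformOnPoints, integral_map Measurable.of_discrete.aemeasurable
    Measurable.of_discrete.aestronglyMeasurable, uniformIndex, PMF.integral_eq_sum]
  simp [PMF.uniformOfFintype_apply, ← Finset.mul_sum, div_eq_inv_mul]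

/-- A finitely supported distribution measures all sets of sequences. -/
lemma isDistribution_uniformOnPoints {m : ℕ} [NeZero m] (x : Fin m → X) :
    IsDistribution (uniformOnPoints x) := by
  refine ⟨inferInstance, fun n s => ?_⟩
  have hmap : Measure.pi (fun _ : Fin n => uniformOnPoints x) =
      (Measure.pi fun _ : Fin n => uniformIndex m).map fun I i => x (I i) := by
    have : ∀ _ : Fin n, SigmaFinite ((uniformIndex m).map x) := fun _ =>
      inferInstanceAs (SigmaFinite (uniformOnPoints x))
    exact (Measure.pi_map_pi (μ := fun _ : Fin n => uniformIndex m) (f := fun _ => x)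
      fun _ => Measurable.of_discrete.aemeasurable).symm
  rw [hmap]
  set f : (Fin n → Fin m) → (Fin n → X) := fun I i => x (I i)
  have hfin : (Set.range f).Finite := Set.finite_range f
  have hae : ∀ᵐ z ∂(Measure.pi fun _ : Fin n => uniformIndex m).map f, z ∈ Set.range f :=
    ae_map_mem_range f hfin.measurableSet _
  refine ((hfin.inter_of_right s).measurableSet.nullMeasurableSet).congr ?_
  filter_upwards [hae] with z hz
  exact propext ⟨fun h => h.1, fun h => ⟨h, hz⟩⟩

/-- For a deterministic predictor the examples are functions of the individuals. -/
lemma exampleLaw_bitPredictor {m : ℕ} [NeZero m] {x : Fin m → X} (hx : Function.Injective x)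
    (b : Fin m → Bool) :
    exampleLaw (uniformOnPoints x) (bitPredictor x b) =
      (uniformIndex m).map fun i => (x i, b i) := by
  refine Measure.ext fun s hs => ?_
  rw [exampleLaw, Measure.compProd_apply hs, uniformOnPoints,
    lintegral_map Measurable.of_discrete Measurable.of_discrete,
    Measure.map_apply Measurable.of_discrete hs, ← lintegral_indicator_one .of_discrete]
  refine lintegral_congr fun i => ?_
  change ber (bitPredictor x b (x i)) _ = _
  have hber : ber (bitPredictor x b (x i)) = Measure.dirac (b i) := by
    rw [bitPredictor_apply hx]
    cases b i <;> simp [ber]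
  rw [hber, Measure.dirac_apply]
  rfl

/-- Two bit predictors that are both close to a common predictor have close bits: otherwise two
members of `D` that realize opposite patterns on the differing bits distinguish them. -/
lemma six_mul_hammingDist_le {D : Set (Distinguisher X)} {ε : ℝ} (hε : 0 < ε) {m : ℕ} [NeZero m]
    {x : Fin m → X} (hx : FatShattered (functionClass D) (12 * ε) x) {p : Predictor X}
    {b b₀ : Fin m → Bool} (hb : advClass (uniformOnPoints x) D p (bitPredictor x b) ≤ ε)
    (hb₀ : advClass (uniformOnPoints x) D p (bitPredictor x b₀) ≤ ε) :
    6 * hammingDist b b₀ ≤ m := by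
  have hinj := hx.injective (by positivity)
  obtain ⟨r, hr⟩ := hx
  set c : Fin m → ℝ := fun i => (if b i then 1 else 0) - (if b₀ i then 1 else 0) with hc
  have hm : (0 : ℝ) < m := by exact_mod_cast Nat.pos_of_ne_zero (NeZero.ne m)
  have hsmall : ∀ d ∈ D, |∑ i, c i * d.toFun (x i)| ≤ 2 * ε * m := by
    intro d hd
    have h1 : adv (uniformOnPoints x) d p (bitPredictor x b) ≤ ε :=
      (adv_le_advClass _ hd _ _).trans hb
    have h2 : adv (uniformOnPoints x) d p (bitPredictor x b₀) ≤ ε :=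
      (adv_le_advClass _ hd _ _).trans hb₀
    have h3 : adv (uniformOnPoints x) d (bitPredictor x b) (bitPredictor x b₀) ≤ 2 * ε := by
      rw [adv, abs_le] at *
      constructor <;> linarith [h1.1, h1.2, h2.1, h2.2]
    have h4 : ∀ i, ((bitPredictor x b (x i) : ℝ) - bitPredictor x b₀ (x i)) = c i := fun i => by
      rw [bitPredictor_apply hinj, bitPredictor_apply hinj]
      simp only [hc]
      split_ifs <;> simp
    rw [adv_eq, integral_uniformOnPoints, abs_div, abs_of_pos hm, div_le_iff₀ hm] at h3
    simpa only [h4] using h3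
  obtain ⟨_, ⟨d, hd, rfl⟩, hd'⟩ := hr (fun i => if b i then 1 else -1)
    (fun i => by split_ifs <;> simp)
  obtain ⟨_, ⟨e, he, rfl⟩, he'⟩ := hr (fun i => if b i then -1 else 1)
    (fun i => by split_ifs <;> simp)
  have hpt : ∀ i, (if b i ≠ b₀ i then 24 * ε else 0) ≤ c i * d.toFun (x i) - c i * e.toFun (x i) := by
    intro i
    have h1 := hd' i
    have h2 := he' i
    simp only [hc]
    cases hbi : b i <;> cases hbi₀ : b₀ i <;> simp [hbi] at h1 h2 ⊢ <;> linarith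
  have hsum := Finset.sum_le_sum fun i (_ : i ∈ Finset.univ) => hpt i
  rw [Finset.sum_sub_distrib, Finset.sum_ite, Finset.sum_const_zero, add_zero, Finset.sum_const,
    nsmul_eq_mul] at hsum
  change (hammingDist b b₀ : ℝ) * _ ≤ _ at hsum
  have h1 := abs_le.1 (hsmall d hd)
  have h2 := abs_le.1 (hsmall e he)
  have h3 : (hammingDist b b₀ : ℝ) * (24 * ε) ≤ 4 * ε * m := by linarith [h1.2, h2.1]
  have h4 : ε * (6 * (hammingDist b b₀ : ℝ)) ≤ ε * m := by linarith
  have h5 := le_of_mul_le_mul_left h4 hε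
  exact_mod_cast h5

open Classical in
/-- One predictor is correct for few bit predictors, because these lie in a small Hamming ball. -/
lemma card_compatible_le {D : Set (Distinguisher X)} {ε : ℝ} (hε : 0 < ε) {m : ℕ} [NeZero m]
    {x : Fin m → X} (hx : FatShattered (functionClass D) (12 * ε) x) (p : Predictor X) :
    ((Finset.univ.filter fun b : Fin m → Bool =>
      advClass (uniformOnPoints x) D p (bitPredictor x b) ≤ ε).card : ℝ) ≤
      (2 : ℝ) ^ (7 / 8 * m : ℝ) := by
  rcases (Finset.univ.filter fun b : Fin m → Bool =>
      advClass (uniformOnPoints x) D p (bitPredictor x b) ≤ ε).eq_empty_or_nonempty with h | ⟨b₀, h⟩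
  · rw [h]
    simp only [Finset.card_empty, Nat.cast_zero]
    positivity
  · refine le_trans ?_ (card_hamming_ball_le b₀)
    exact_mod_cast Finset.card_le_card fun b hb => Finset.mem_filter.2 ⟨Finset.mem_univ _,
      six_mul_hammingDist_le hε hx (Finset.mem_filter.1 hb).2 (Finset.mem_filter.1 h).2⟩

/-- Counting: given the individuals and the seed there are at most `2 ^ n` possible outputs, and each
of them is correct for few of the `2 ^ m` bit predictors. -/
lemma two_pow_le_of_mem_DFR {D : Set (Distinguisher X)} {ε δ : ℝ} (hε : 0 < ε) (hδ : 0 ≤ δ)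
    {m n : ℕ} [NeZero m] {x : Fin m → X} (hx : FatShattered (functionClass D) (12 * ε) x)
    {A : Learner X n} (hA : A ∈ DFR n Set.univ D ε δ) :
    (1 - δ) * 2 ^ m ≤ 2 ^ n * (2 : ℝ) ^ (7 / 8 * m : ℝ) := by
  classical
  have hinj := hx.injective (by positivity)
  set μ := uniformOnPoints x with hμ
  set ρ := (Measure.pi fun _ : Fin n => uniformIndex m).prod A.seedLaw with hρ
  set φ : (Fin m → Bool) → (Fin n → Fin m) × A.Seed → (Fin n → X × Bool) × A.Seed :=
    fun b w => (fun i => (x (w.1 i), b (w.1 i)), w.2) with hφ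
  have hφm : ∀ b, Measurable (φ b) := fun b =>
    ((Measurable.of_discrete (f := fun (I : Fin n → Fin m) i => (x (I i), b (I i)))).comp
      measurable_fst).prodMk measurable_snd
  have hlaw : ∀ b, A.jointLaw μ (bitPredictor x b) = ρ.map (φ b) := by
    intro b
    have hsf : ∀ _ : Fin n, SigmaFinite ((uniformIndex m).map fun i => (x i, b i)) := fun _ => by
      rw [← exampleLaw_bitPredictor hinj b]; infer_instance
    have h1 := Measure.pi_map_pi (μ := fun _ : Fin n => uniformIndex m)
      (f := fun _ i => (x i, b i)) fun _ => Measurable.of_discrete.aemeasurable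
    have h2 : SFinite ((Measure.pi fun _ : Fin n => uniformIndex m).map
        fun I i => (x (I i), b (I i))) := inferInstance
    rw [Learner.jointLaw, hμ, exampleLaw_bitPredictor hinj, ← h1]
    conv_lhs => rw [← Measure.map_id (μ := A.seedLaw)]
    rw [Measure.map_prod_map _ _ Measurable.of_discrete measurable_id]
    rfl
  set fail : (Fin m → Bool) → Set ((Fin n → X × Bool) × A.Seed) := fun b =>
    {z | ¬ advClass μ D (A.run z.1 z.2) (bitPredictor x b) ≤ ε} with hfail
  have hfle : ∀ b, ρ.map (φ b) (fail b) ≤ ENNReal.ofReal δ := by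
    intro b
    have h := hA
    simp only [DFR, DSR, Set.mem_iInter, Set.mem_ofPred_eq, Set.mem_univ, forall_true_left] at h
    have := h μ (isDistribution_uniformOnPoints x) (bitPredictor x b)
    rwa [OI, Set.mem_ofPred_eq, hlaw] at this
  -- The failure event need not be measurable, so success is replaced by the complement of a
  -- measurable hull of failure.
  set S : (Fin m → Bool) → Set ((Fin n → Fin m) × A.Seed) := fun b =>
    (φ b ⁻¹' toMeasurable (ρ.map (φ b)) (fail b))ᶜ with hS
  have hSm : ∀ b, MeasurableSet (S b) := fun b =>
    (hφm b (measurableSet_toMeasurable _ _)).compl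
  have hSle : ∀ b, ENNReal.ofReal (1 - δ) ≤ ρ (S b) := by
    intro b
    rw [hS, prob_compl_eq_one_sub (hφm b (measurableSet_toMeasurable _ _)),
      ← Measure.map_apply (hφm b) (measurableSet_toMeasurable _ _), measure_toMeasurable,
      ENNReal.ofReal_sub _ hδ, ENNReal.ofReal_one]
    exact tsub_le_tsub_left (hfle b) 1
  have hScorrect : ∀ b w, w ∈ S b → advClass μ D (A.run (φ b w).1 w.2) (bitPredictor x b) ≤ ε := by
    intro b w hw
    by_contra hcon
    exact hw (subset_toMeasurable _ _ hcon)
  have hcount : ∀ w, ((Finset.univ.filter fun b => w ∈ S b).card : ℝ) ≤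
      2 ^ n * (2 : ℝ) ^ (7 / 8 * m : ℝ) := by
    intro w
    have hsub : (Finset.univ.filter fun b => w ∈ S b) ⊆
        (Finset.univ : Finset (Fin n → Bool)).biUnion fun o =>
          Finset.univ.filter fun b : Fin m → Bool =>
            advClass μ D (A.run (fun i => (x (w.1 i), o i)) w.2) (bitPredictor x b) ≤ ε := by
      intro b hb
      exact Finset.mem_biUnion.2 ⟨fun i => b (w.1 i), Finset.mem_univ _, Finset.mem_filter.2
        ⟨Finset.mem_univ _, hScorrect b w (Finset.mem_filter.1 hb).2⟩⟩
    have h1 : ((Finset.univ.filter fun b => w ∈ S b).card : ℝ) ≤ ∑ o : Fin n → Bool,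
        ((Finset.univ.filter fun b : Fin m → Bool =>
          advClass μ D (A.run (fun i => (x (w.1 i), o i)) w.2) (bitPredictor x b) ≤ ε).card : ℝ) := by
      exact_mod_cast (Finset.card_le_card hsub).trans Finset.card_biUnion_le
    refine h1.trans ((Finset.sum_le_sum fun o _ => card_compatible_le hε hx _).trans ?_)
    rw [Finset.sum_const, nsmul_eq_mul]
    simp
  have hsum : ENNReal.ofReal ((1 - δ) * 2 ^ m) ≤
      ENNReal.ofReal (2 ^ n * (2 : ℝ) ^ (7 / 8 * m : ℝ)) := by
    calc ENNReal.ofReal ((1 - δ) * 2 ^ m) = ∑ b : Fin m → Bool, ENNReal.ofReal (1 - δ) := by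
          rw [Finset.sum_const, nsmul_eq_mul, mul_comm, ENNReal.ofReal_mul (by positivity),
            ENNReal.ofReal_pow (by norm_num)]
          simp
      _ ≤ ∑ b, ρ (S b) := Finset.sum_le_sum fun b _ => hSle b
      _ = ∫⁻ w, ∑ b, (S b).indicator 1 w ∂ρ := by
          rw [lintegral_finsetSum _ fun b _ => measurable_one.indicator (hSm b)]
          exact Finset.sum_congr rfl fun b _ => (lintegral_indicator_one (hSm b)).symm
      _ ≤ ∫⁻ w, ENNReal.ofReal (2 ^ n * (2 : ℝ) ^ (7 / 8 * m : ℝ)) ∂ρ := by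
          refine lintegral_mono fun w => ?_
          have : ∑ b, (S b).indicator (1 : _ × A.Seed → ENNReal) w =
              ((Finset.univ.filter fun b => w ∈ S b).card : ENNReal) := by
            rw [← Finset.sum_boole]
            exact Finset.sum_congr rfl fun b _ => by by_cases h : w ∈ S b <;> simp [h]
          rw [this, ← ENNReal.ofReal_natCast]
          exact ENNReal.ofReal_le_ofReal (hcount w)
      _ = _ := by simp [hρ]
  exact (ENNReal.ofReal_le_ofReal_iff (by positivity)).1 hsum

lemma lower_bound_of_mem_DFR {D : Set (Distinguisher X)} {ε δ : ℝ} (hε : 0 < ε) (hδ0 : 0 ≤ δ)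
    (hδ1 : δ < 1) {m n : ℕ} {x : Fin m → X} (hx : FatShattered (functionClass D) (12 * ε) x)
    {A : Learner X n} (hA : A ∈ DFR n Set.univ D ε δ) :
    (m : ℝ) / 8 + Real.logb 2 (1 - δ) ≤ n := by
  rcases Nat.eq_zero_or_pos m with rfl | hm
  · have : Real.logb 2 (1 - δ) ≤ 0 :=
      Real.logb_nonpos (by norm_num) (by linarith) (by linarith)
    have hn : (0 : ℝ) ≤ n := by positivity
    simp only [Nat.cast_zero, zero_div, zero_add]
    linarith
  · have : NeZero m := ⟨hm.ne'⟩
    have h := two_pow_le_of_mem_DFR hε hδ0 hx hA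
    have hpos : 0 < 1 - δ := by linarith
    have h1 := Real.logb_le_logb_of_le (b := 2) (by norm_num) (by positivity) h
    rw [Real.logb_mul hpos.ne' (by positivity), Real.logb_mul (by positivity) (by positivity),
      Real.logb_pow, Real.logb_pow, Real.logb_rpow (by norm_num) (by norm_num),
      Real.logb_self_eq_one (by norm_num)] at h1
    linarith

end LowerBound

/-! ### Sample complexities as extended numbers -/

@[simp] lemma toER_natCast (n : ℕ) : toER (n : ℕ∞) = ((n : ℝ) : EReal) := by
  rw [toER, ENat.toENNReal_coe]
  exact EReal.coe_nnreal_eq_coe_real (n : NNReal)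

@[simp] lemma toER_top : toER ⊤ = ⊤ := by simp [toER]

lemma toER_mono {a b : ℕ∞} (h : a ≤ b) : toER a ≤ toER b := by
  simpa [toER] using h

/-- A finite fat-shattering dimension is attained by a shattered sequence. -/
lemma exists_fatShattered_of_bounded {X : Type*} {F : Set (X → ℝ)} {γ : ℝ} {B : ℝ}
    (hB : ∀ (m : ℕ) (x : Fin m → X), FatShattered F γ x → (m : ℝ) ≤ B) (hB0 : 0 ≤ B) :
    ∃ k : ℕ, fat F γ = k ∧ (k : ℝ) ≤ B := by
  have hle : fat F γ ≤ (⌊B⌋₊ : ℕ) := by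
    refine iSup₂_le fun m ⟨x, hx⟩ => ?_
    exact_mod_cast Nat.le_floor (hB m x hx)
  obtain ⟨k, hk⟩ := ENat.ne_top_iff_exists.1 (ne_top_of_le_ne_top (ENat.natCast_ne_top _) hle)
  refine ⟨k, hk.symm, ?_⟩
  rw [← hk] at hle
  have : k ≤ ⌊B⌋₊ := by exact_mod_cast hle
  exact (Nat.cast_le.2 this).trans (Nat.floor_le hB0)

section

variable {X : Type*} [MeasurableSpace X] [DiscreteMeasurableSpace X]

/-- With all predictors available the best advantage is `0`, attained by `p*` itself, so agnostic and
realizable learning coincide. -/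
lemma DSA_univ_eq_DSR_univ (n : ℕ) (D : Set (Distinguisher X)) (ε δ : ℝ) (μ : Measure X) :
    DSA n Set.univ D ε δ μ = DSR n Set.univ D ε δ μ := by
  have hinf : ∀ q : Predictor X,
      (⨅ p : (Set.univ : Set (Predictor X)), advClass μ D p.1 q) = 0 := by
    intro q
    refine le_antisymm ?_ (Real.iInf_nonneg fun p => advClass_nonneg μ D p.1 q)
    refine (ciInf_le ⟨0, ?_⟩ ⟨q, Set.mem_univ q⟩).trans (le_of_eq ?_)
    · rintro _ ⟨p, rfl⟩
      exact advClass_nonneg μ D p.1 q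
    · simp [advClass, adv]
  simp only [DSA, DSR, hinf, zero_add, Set.mem_univ, Set.iInter_true]

lemma sampDFR_univ_eq_sampDFA_univ (D : Set (Distinguisher X)) (ε δ : ℝ) :
    sampDFR Set.univ D ε δ = sampDFA Set.univ D ε δ := by
  simp only [sampDFR, sampDFA, DFR, DFA, DSA_univ_eq_DSR_univ]

lemma sampDFR_le {P : Set (Predictor X)} {D : Set (Distinguisher X)} {ε δ : ℝ} {n : ℕ}
    (h : (DFR n P D ε δ).Nonempty) : sampDFR P D ε δ ≤ n :=
  iInf₂_le n h

/-- A finite sample complexity is attained by some learner. -/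
lemma exists_learner_of_sampDFR_ne_top {P : Set (Predictor X)} {D : Set (Distinguisher X)}
    {ε δ : ℝ} (h : sampDFR P D ε δ ≠ ⊤) :
    ∃ n : ℕ, sampDFR P D ε δ = n ∧ (DFR n P D ε δ).Nonempty := by
  classical
  have hne : ∃ n : ℕ, (DFR n P D ε δ).Nonempty := by
    by_contra! hno
    exact h (by simp [sampDFR, hno])
  exact ⟨Nat.find hne, le_antisymm (sampDFR_le (Nat.find_spec hne))
    (le_iInf₂ fun n hn => by exact_mod_cast Nat.find_min' hne hn), Nat.find_spec hne⟩

lemma lower_bound {D : Set (Distinguisher X)} {ε δ : ℝ} (hε : 0 < ε) (hδ0 : 0 ≤ δ) (hδ1 : δ < 1) :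
    toER (fat (functionClass D) (12 * ε)) / 8 + ((Real.logb 2 (1 - δ) : ℝ) : EReal) ≤
      toER (sampDFR Set.univ D ε δ) := by
  by_cases htop : sampDFR Set.univ D ε δ = ⊤
  · rw [htop, toER_top]
    exact le_top
  · obtain ⟨n, hn, A, hA⟩ := exists_learner_of_sampDFR_ne_top htop
    have hB : ∀ (m : ℕ) (x : Fin m → X), FatShattered (functionClass D) (12 * ε) x →
        (m : ℝ) ≤ 8 * (n - Real.logb 2 (1 - δ)) := fun m x hx => by
      linarith [lower_bound_of_mem_DFR hε hδ0 hδ1 hx hA]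
    have hlog : Real.logb 2 (1 - δ) ≤ 0 :=
      Real.logb_nonpos (by norm_num) (by linarith) (by linarith)
    have hn0 : (0 : ℝ) ≤ n := by positivity
    obtain ⟨k, hk, hkB⟩ := exists_fatShattered_of_bounded hB (by linarith)
    rw [hk, hn, toER_natCast, toER_natCast]
    have : ((k : ℝ) : EReal) / 8 = (((k : ℝ) / 8 : ℝ) : EReal) := by
      rw [EReal.coe_div]; rfl
    rw [this, ← EReal.coe_add, EReal.coe_le_coe_iff]
    linarith

lemma upper_bound {D : Set (Distinguisher X)} (hD : D.Nonempty) {ε δ : ℝ} (h0 : 0 < ε)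
    (h1 : ε < 1) (hδ0 : 0 < δ) (hδ1 : δ < 1) :
    toER (sampDFR Set.univ D ε δ) ≤ ((20000000000 * (ε ^ 4)⁻¹ : ℝ) : EReal) *
      (toER (fat (functionClass D) (ε / 25)) * ((Real.logb 2 (2 / ε) ^ 2 : ℝ) : EReal) +
        ((Real.logb 2 (2 / δ) : ℝ) : EReal)) := by
  rcases eq_or_ne (fat (functionClass D) (ε / 25)) ⊤ with htop | hfin
  · have hL := one_le_logb_two_div h0 h1
    rw [htop, toER_top, EReal.top_mul_coe_of_pos (by positivity), EReal.top_add_coe,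
      EReal.coe_mul_top_of_pos (by positivity)]
    exact le_top
  · obtain ⟨d, hd⟩ := ENat.ne_top_iff_exists.1 hfin
    obtain ⟨n, hn, hle⟩ := exists_sample_size hD h0 h1 hδ0 hδ1 (d := d) hd.ge
    refine (toER_mono (sampDFR_le hn)).trans ?_
    rw [← hd, toER_natCast, toER_natCast, ← EReal.coe_mul, ← EReal.coe_add, ← EReal.coe_mul,
      EReal.coe_le_coe_iff]
    exact hle

end

end OutcomeInd

theorem mainTheorem3 :
    ∃ C : ℝ, 0 < C ∧
      ∀ (X : Type*) [Nonempty X] [MeasurableSpace X] [DiscreteMeasurableSpace X]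
        (D : Set (OutcomeInd.Distinguisher X)) (ε δ : ℝ),
        D.Nonempty → 0 < ε → ε < 1 → 0 < δ → δ < 1 →
        OutcomeInd.toER (OutcomeInd.fat (OutcomeInd.functionClass D) (12 * ε)) / 8
              + ((Real.logb 2 (1 - δ) : ℝ) : EReal)
            ≤ OutcomeInd.toER (OutcomeInd.sampDFR Set.univ D ε δ) ∧
        OutcomeInd.sampDFR Set.univ D ε δ = OutcomeInd.sampDFA Set.univ D ε δ ∧
        OutcomeInd.toER (OutcomeInd.sampDFA Set.univ D ε δ)
            ≤ ((C * (ε ^ 4)⁻¹ : ℝ) : EReal) *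
                (OutcomeInd.toER (OutcomeInd.fat (OutcomeInd.functionClass D) (ε / 25))
                    * ((Real.logb 2 (2 / ε) ^ 2 : ℝ) : EReal)
                  + ((Real.logb 2 (2 / δ) : ℝ) : EReal)) := by
  refine ⟨20000000000, by norm_num, fun X _ _ _ D ε δ hD hε0 hε1 hδ0 hδ1 =>
    ⟨OutcomeInd.lower_bound hε0 hδ0.le hδ1, OutcomeInd.sampDFR_univ_eq_sampDFA_univ D ε δ, ?_⟩⟩
  rw [← OutcomeInd.sampDFR_univ_eq_sampDFA_univ]
  exact OutcomeInd.upper_bound hD hε0 hε1 hδ0 hδ1
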